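/- Let $D\in\mathbb{R}^{m\times n}$, $\Omega\subseteq\{1,\dots,m\}\times\{1,\dots,n\}$ (the observed entries), $d\in\mathbb{N}$ and $\lambda>0$. Let $\mathcal{P}_\Omega$ set the entries outside $\Omega$ to zero, let $\mathcal{P}_{\Omega^c}$ set those inside $\Omega$ to zero, let $\|\cdot\|_*$ be the nuclear norm, and let $\Phi(S)=\|\mathcal{P}_\Omega(S)\|_{\ell_{1/2}}^{1/2}=\sum_{(i,j)\in\Omega}|S_{ij}|^{1/2}$. Consider the problem $$\min_{U,V,L,S,\widehat U,\widehat V}\ \tfrac{\lambda}{2}\bigl(\|\widehat U\|_*+\|\widehat V\|_*\bigr)+\Phi(S)\quad\text{s.t.}\quad \widehat U=U,\ \widehat V=V,\ UV^T=L,\ L+S=D, \tag{P}$$ with $U,\widehat U\in\mathbb{R}^{m\times d}$, $V,\widehat V\in\mathbb{R}^{n\times d}$, $L,S\in\mathbb{R}^{m\times n}$. Given $\mu_k>0$ and arbitrary initial matrices, the ADMM computes, with $M_k=L_k-\mu_k^{-1}Y_3^k$, $$\begin{aligned} U_{k+1}&=(\widehat U_k+\mu_k^{-1}Y_1^k+M_kV_k)(I_d+V_k^TV_k)^{-1},\\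 V_{k+1}&=(\widehat V_k+\mu_k^{-1}Y_2^k+M_k^TU_{k+1})(I_d+U_{k+1}^TU_{k+1})^{-1},\\ \widehat U_{k+1}&=\mathcal{D}_{\lambda/(2\mu_k)}(U_{k+1}-\mu_k^{-1}Y_1^k),\qquad \widehat V_{k+1}=\mathcal{D}_{\lambda/(2\mu_k)}(V_{k+1}-\mu_k^{-1}Y_2^k),\\ L_{k+1}&=\tfrac12\bigl(U_{k+1}V_{k+1}^T+\mu_k^{-1}Y_3^k-S_k+D-\mu_k^{-1}Y_4^k\bigr),\\ S_{k+1}&=\mathcal{P}_\Omega\bigl(\mathcal{H}_{2/\mu_k}(A_k)\bigr)+\mathcal{P}_{\Omega^c}(A_k),\qquad A_k=D-L_{k+1}-\mu_k^{-1}Y_4^k,\\ Y_1^{k+1}&=Y_1^k+\mu_k(\widehat U_{k+1}-U_{k+1}),\qquad Y_2^{k+1}=Y_2^k+\mu_k(\widehat V_{k+1}-V_{k+1}),\\ Y_3^{k+1}&=Y_3^k+\mu_k(U_{k+1}V_{k+1}^T-L_{k+1}),\qquad Y_4^{k+1}=Y_4^k+\mu_k(L_{k+1}+S_{k+1}-D).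 \end{aligned}$$ Here $\mathcal{D}_\tau$ is singular value thresholding ($P\,\mathrm{diag}(\sigma)\,Q^T\mapsto P\,\mathrm{diag}(\max(\sigma-\tau,0))\,Q^T$ on a singular value decomposition), and $\mathcal{H}_\gamma$ acts entrywise by $\mathcal{H}_\gamma(a)=\frac23a\bigl[1+\cos\frac{2\pi-2\phi_\gamma(a)}{3}\bigr]$ if $|a|>\frac{\sqrt[3]{54\gamma^2}}{4}$ and $\mathcal{H}_\gamma(a)=0$ otherwise, with $\phi_\gamma(a)=\arccos\bigl(\frac{\gamma}{8}(|a|/3)^{-3/2}\bigr)$. Suppose that $\{Y_3^k\}$ is bounded, $\mu_k$ is non-decreasing (for instance $\mu_{k+1}=\rho\mu_k$ with $\rho>1$), and $\sum_{k=0}^\infty \mu_{k+1}/\mu_k^{4/3}<\infty$. Then: (I) $\{(U_k,V_k)\}$, $\{(\widehat U_k,\widehat V_k)\}$, $\{L_k\}$ and $\{S_k\}$ are all Cauchy sequences. (II) Any accumulation point $(U_\star,V_\star,\widehat U_\star,\widehat V_\star,L_\star,S_\star)$ of $\{(U_k,V_k,\widehat U_k,\widehat V_k,L_k,S_k)\}$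 satisfies the following KKT conditions for (P) with some multipliers $Y_1^\star,Y_2^\star,Y_4^\star$: $$\begin{gathered}0\in\tfrac{\lambda}{2}\partial\|\widehat U_\star\|_*+Y_1^\star,\quad 0\in\tfrac{\lambda}{2}\partial\|\widehat V_\star\|_*+Y_2^\star,\quad 0\in\partial\Phi(S_\star)+\mathcal{P}_\Omega(Y_4^\star),\quad \mathcal{P}_{\Omega^c}(Y_4^\star)=0,\\ L_\star=U_\star V_\star^T,\quad \widehat U_\star=U_\star,\quad \widehat V_\star=V_\star,\quad L_\star+S_\star=D,\end{gathered}$$ where $\partial\|\cdot\|_*$ is the convex subdifferential and $\partial\Phi$ the limiting subdifferential. Moreover, $Y_1^\star,Y_2^\star$ can be chosen so that $(U_\star,V_\star,\widehat U_\star,\widehat V_\star,L_\star,S_\star,Y_1^\star,Y_2^\star)$ is an accumulation point of the iterates $(U_k,V_k,\widehat U_k,\widehat V_k,L_k,S_k,Y_1^k,Y_2^k)$; and whenever $(U_\star,V_\star,\widehat U_\star,\widehat V_\star,L_\star,S_\star,Y_1^\star,Y_2^\star,Y_4^\star)$ is an accumulation point of $\{(U_k,V_k,\widehat U_k,\widehat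 V_k,L_k,S_k,Y_1^k,Y_2^k,Y_4^k)\}$, the conditions hold with these multipliers. -/

import Mathlib

open Filter Topology Matrix

namespace HalfRPCA

noncomputable section

/-- The Frobenius inner product of two real matrices. -/
def frobInner {m n : ℕ} (A B : Matrix (Fin m) (Fin n) ℝ) : ℝ :=
  ∑ i, ∑ j, A i j * B i j

/-- The Frobenius norm. -/
def frobNorm {m n : ℕ} (A : Matrix (Fin m) (Fin n) ℝ) : ℝ :=
  Real.sqrt (frobInner A A)

/-- The nuclear norm: the sum of the singular values. -/
def nuclearNorm {m n : ℕ} (A : Matrix (Fin m) (Fin n) ℝ) : ℝ :=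
  (Matrix.toEuclideanLin A).singularValues.sum fun _ s => s

open Classical in
/-- The projection onto the matrices supported on `Ω`. -/
def proj {m n : ℕ} (Ω : Set (Fin m × Fin n)) (A : Matrix (Fin m) (Fin n) ℝ) :
    Matrix (Fin m) (Fin n) ℝ :=
  Matrix.of fun i j => if (i, j) ∈ Ω then A i j else 0

/-- The penalty `Φ(S) = ‖P_Ω(S)‖_{ℓ_{1/2}}^{1/2} = ∑ |P_Ω(S)_{ij}|^{1/2}`. -/
def Phi {m n : ℕ} (Ω : Set (Fin m × Fin n)) (S : Matrix (Fin m) (Fin n) ℝ) : ℝ :=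
  ∑ i, ∑ j, |proj Ω S i j| ^ (1 / 2 : ℝ)

/-! ### Subdifferentials -/

/-- The subdifferential of a convex function on a space of real matrices. -/
def convexSubdiff {m n : ℕ} (f : Matrix (Fin m) (Fin n) ℝ → ℝ) (X : Matrix (Fin m) (Fin n) ℝ) :
    Set (Matrix (Fin m) (Fin n) ℝ) :=
  {G | ∀ Z, f X + frobInner G (Z - X) ≤ f Z}

/-- The Fréchet subdifferential:
`liminf_{Z → X, Z ≠ X} (f Z - f X - ⟨G, Z - X⟩) / ‖Z - X‖ ≥ 0`. -/
def frechetSubdiff {m n : ℕ} (f : Matrix (Fin m) (Fin n) ℝ → ℝ) (X : Matrix (Fin m) (Fin n) ℝ) :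
    Set (Matrix (Fin m) (Fin n) ℝ) :=
  {G | ∀ ε : ℝ, 0 < ε → ∀ᶠ Z in 𝓝 X,
    f X + frobInner G (Z - X) - ε * frobNorm (Z - X) ≤ f Z}

/-- The limiting subdifferential. -/
def limitingSubdiff {m n : ℕ} (f : Matrix (Fin m) (Fin n) ℝ → ℝ) (X : Matrix (Fin m) (Fin n) ℝ) :
    Set (Matrix (Fin m) (Fin n) ℝ) :=
  {G | ∃ (x g : ℕ → Matrix (Fin m) (Fin n) ℝ),
    Tendsto x atTop (𝓝 X) ∧ Tendsto (fun k => f (x k)) atTop (𝓝 (f X)) ∧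
    (∀ k, g k ∈ frechetSubdiff f (x k)) ∧ Tendsto g atTop (𝓝 G)}

/-! ### Thresholding operators -/

/-- `X = D_τ(Y)` for the singular value thresholding operator: `Y = P diag(σ) Qᵀ` is a singular
value decomposition of `Y` and `X = P diag(max(σ - τ, 0)) Qᵀ`. -/
def IsSVT {m n : ℕ} (τ : ℝ) (Y X : Matrix (Fin m) (Fin n) ℝ) : Prop :=
  ∃ (r : ℕ) (P : Matrix (Fin m) (Fin r) ℝ) (Q : Matrix (Fin n) (Fin r) ℝ) (σ : Fin r → ℝ),
    Pᵀ * P = 1 ∧ Qᵀ * Q = 1 ∧ (∀ i, 0 ≤ σ i) ∧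
    Y = P * Matrix.diagonal σ * Qᵀ ∧
    X = P * Matrix.diagonal (fun i => max (σ i - τ) 0) * Qᵀ

open Classical in
/-- The scalar half-thresholding operator `H_γ`. -/
def halfThreshold (γ a : ℝ) : ℝ :=
  if (54 * γ ^ 2) ^ (1 / 3 : ℝ) / 4 < |a| then
    2 / 3 * a * (1 + Real.cos
      ((2 * Real.pi - 2 * Real.arccos (γ / 8 * (|a| / 3) ^ (-(3 / 2) : ℝ))) / 3))
  else 0

/-- The entrywise half-thresholding operator. -/
def halfThresholdMat {m n : ℕ} (γ : ℝ) (A : Matrix (Fin m) (Fin n) ℝ) :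
    Matrix (Fin m) (Fin n) ℝ :=
  A.map (halfThreshold γ)

/-! ### The algorithm -/

/-- The variables and multipliers of the ADMM iteration. -/
structure State (m n d : ℕ) where
  U : Matrix (Fin m) (Fin d) ℝ
  V : Matrix (Fin n) (Fin d) ℝ
  Uhat : Matrix (Fin m) (Fin d) ℝ
  Vhat : Matrix (Fin n) (Fin d) ℝ
  L : Matrix (Fin m) (Fin n) ℝ
  S : Matrix (Fin m) (Fin n) ℝ
  Y₁ : Matrix (Fin m) (Fin d) ℝ
  Y₂ : Matrix (Fin n) (Fin d) ℝ
  Y₃ : Matrix (Fin m) (Fin n) ℝ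
  Y₄ : Matrix (Fin m) (Fin n) ℝ

/-- The tuple `(U, V, Û, V̂, L, S)` of primal variables. -/
def State.primal {m n d : ℕ} (x : State m n d) :
    Matrix (Fin m) (Fin d) ℝ × Matrix (Fin n) (Fin d) ℝ ×
    Matrix (Fin m) (Fin d) ℝ × Matrix (Fin n) (Fin d) ℝ ×
    Matrix (Fin m) (Fin n) ℝ × Matrix (Fin m) (Fin n) ℝ :=
  (x.U, x.V, x.Uhat, x.Vhat, x.L, x.S)

/-- One iteration of the ADMM with penalty parameter `μ`, from the state `x` to the state `x'`
(one pass through the inner loop, then the update of the multipliers). -/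
structure ADMMStep {m n d : ℕ} (Ω : Set (Fin m × Fin n)) (D : Matrix (Fin m) (Fin n) ℝ)
    (lam μ : ℝ) (x x' : State m n d) : Prop where
  U_eq : x'.U = (x.Uhat + μ⁻¹ • x.Y₁ + (x.L - μ⁻¹ • x.Y₃) * x.V) * (1 + x.Vᵀ * x.V)⁻¹
  V_eq : x'.V = (x.Vhat + μ⁻¹ • x.Y₂ + (x.L - μ⁻¹ • x.Y₃)ᵀ * x'.U) * (1 + x'.Uᵀ * x'.U)⁻¹
  Uhat_svt : IsSVT (lam / (2 * μ)) (x'.U - μ⁻¹ • x.Y₁) x'.Uhat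
  Vhat_svt : IsSVT (lam / (2 * μ)) (x'.V - μ⁻¹ • x.Y₂) x'.Vhat
  L_eq : x'.L = (1 / 2 : ℝ) • (x'.U * x'.Vᵀ + μ⁻¹ • x.Y₃ - x.S + D - μ⁻¹ • x.Y₄)
  S_eq : x'.S = proj Ω (halfThresholdMat (2 / μ) (D - x'.L - μ⁻¹ • x.Y₄)) +
    proj Ωᶜ (D - x'.L - μ⁻¹ • x.Y₄)
  Y₁_eq : x'.Y₁ = x.Y₁ + μ • (x'.Uhat - x'.U)
  Y₂_eq : x'.Y₂ = x.Y₂ + μ • (x'.Vhat - x'.V)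
  Y₃_eq : x'.Y₃ = x.Y₃ + μ • (x'.U * x'.Vᵀ - x'.L)
  Y₄_eq : x'.Y₄ = x.Y₄ + μ • (x'.L + x'.S - D)

/-- The KKT conditions of the split problem, for the point `(U, V, Û, V̂, L, S)` and the
multipliers `Y₁`, `Y₂`, `Y₄`. -/
structure IsKKT {m n d : ℕ} (Ω : Set (Fin m × Fin n)) (D : Matrix (Fin m) (Fin n) ℝ) (lam : ℝ)
    (U : Matrix (Fin m) (Fin d) ℝ) (V : Matrix (Fin n) (Fin d) ℝ)
    (Uhat : Matrix (Fin m) (Fin d) ℝ) (Vhat : Matrix (Fin n) (Fin d) ℝ)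
    (L S : Matrix (Fin m) (Fin n) ℝ)
    (Y₁ : Matrix (Fin m) (Fin d) ℝ) (Y₂ : Matrix (Fin n) (Fin d) ℝ)
    (Y₄ : Matrix (Fin m) (Fin n) ℝ) : Prop where
  stat_Uhat : ∃ G ∈ convexSubdiff nuclearNorm Uhat, (lam / 2) • G + Y₁ = 0
  stat_Vhat : ∃ G ∈ convexSubdiff nuclearNorm Vhat, (lam / 2) • G + Y₂ = 0
  stat_S : ∃ G ∈ limitingSubdiff (Phi Ω) S, G + proj Ω Y₄ = 0
  off_support : proj Ωᶜ Y₄ = 0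
  feas_L : L = U * Vᵀ
  feas_Uhat : Uhat = U
  feas_Vhat : Vhat = V
  feas_D : L + S = D

end

end HalfRPCA

/-! Everything rests on boundedness of the multipliers. Singular value thresholding is the proximal
map of the nuclear norm, so after one step `Y₁` and `Y₂` equal `-(lam / 2) • G` with `G` a
subgradient of operator norm at most 1 (`IsSVT.exists_dual`); `Y₃` is bounded by assumption. The
residuals `Uhat - U`, `Vhat - V` and `U * Vᵀ - L` are differences of consecutive multipliers divided
by `μ k`, hence O(1 / `μ k`).

The updates of `U` and `V` are regularized least squares solutions, which move by at most the size
of the residuals at the old point, however large the other factor is (`opNorm_leastSquares_sub_le`).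
So `U` moves by O(1 / `μ k`). The residual for `V` also contains the change of `U` times `Vᵀ`, which
costs a factor `1 + ‖V‖`; a discrete Grönwall inequality absorbs it. Since 1 / `μ k` is summable,
`U` and `V` converge, and `Uhat`, `Vhat`, `L` follow.

No bound on `Y₄` is available or needed. Half-thresholding moves a number by at most γ^(2/3) with γ
= 2 / `μ k`, so `Y₄ / μ` is O(`μ k` ^ (-2/3)). This sends `L + S - D` to 0 and makes `S` converge.

For the KKT conditions, the subdifferential of the nuclear norm has closed graph, and compactness
supplies limits of `Y₁` and `Y₂`. On `Ω`, wherever `S` is nonzero, the iterates satisfy `Y₄ =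
-halfGrad S` exactly; where `S` vanishes, the infinite slope of |s|^(1/2) admits every multiplier.
-/

namespace HalfRPCA

/-! ### The Frobenius inner product -/

lemma frobInner_eq_trace {m n : ℕ} (A B : Matrix (Fin m) (Fin n) ℝ) :
    frobInner A B = (Aᵀ * B).trace := by
  simp only [frobInner, trace, diag, mul_apply, transpose_apply]
  exact Finset.sum_comm

/-- Both sides are the trace of the adjoint of `A` composed with `B`, which does not depend on the
orthonormal basis. -/
lemma frobInner_eq_sum_inner {m n : ℕ} (A B : Matrix (Fin m) (Fin n) ℝ)
    (b : OrthonormalBasis (Fin n) ℝ (EuclideanSpace ℝ (Fin n))) :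
    frobInner A B = ∑ i, inner ℝ (toEuclideanLin A (b i)) (toEuclideanLin B (b i)) := by
  have key : ∀ c : OrthonormalBasis (Fin n) ℝ (EuclideanSpace ℝ (Fin n)),
      ∑ i, inner ℝ (toEuclideanLin A (c i)) (toEuclideanLin B (c i)) =
        LinearMap.trace ℝ _ ((toEuclideanLin A).adjoint ∘ₗ toEuclideanLin B) := by
    intro c
    rw [LinearMap.trace_eq_sum_inner _ c]
    exact Finset.sum_congr rfl fun i _ => by
      rw [LinearMap.comp_apply, LinearMap.adjoint_inner_right]
  rw [key b, ← key (EuclideanSpace.basisFun (Fin n) ℝ), frobInner, Finset.sum_comm]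
  refine Finset.sum_congr rfl fun j _ => ?_
  simp [PiLp.inner_apply, toLpLin_apply, mul_comm]

lemma frobInner_sub_right {m n : ℕ} (A B C : Matrix (Fin m) (Fin n) ℝ) :
    frobInner A (B - C) = frobInner A B - frobInner A C := by
  simp [frobInner, mul_sub, Finset.sum_sub_distrib]

section OperatorNorm

open scoped Matrix.Norms.L2Operator

/-! ### The operator norm -/

lemma norm_toEuclideanLin_le {m n : ℕ} (A : Matrix (Fin m) (Fin n) ℝ)
    (v : EuclideanSpace ℝ (Fin n)) : ‖toEuclideanLin A v‖ ≤ ‖A‖ * ‖v‖ :=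
  A.l2_opNorm_mulVec v

lemma opNorm_le_of_forall {m n : ℕ} (A : Matrix (Fin m) (Fin n) ℝ) {M : ℝ} (hM : 0 ≤ M)
    (h : ∀ v, ‖toEuclideanLin A v‖ ≤ M * ‖v‖) : ‖A‖ ≤ M := by
  rw [l2_opNorm_def]
  exact ContinuousLinearMap.opNorm_le_bound _ hM h

lemma abs_apply_le_opNorm {m n : ℕ} (A : Matrix (Fin m) (Fin n) ℝ) (i : Fin m) (j : Fin n) :
    |A i j| ≤ ‖A‖ := by
  have h := norm_toEuclideanLin_le A (EuclideanSpace.single j 1)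
  have h2 := PiLp.norm_apply_le (toEuclideanLin A (EuclideanSpace.single j 1)) i
  simp [toLpLin_apply] at h h2
  exact h2.trans h

lemma opNorm_transpose {m n : ℕ} (A : Matrix (Fin m) (Fin n) ℝ) : ‖Aᵀ‖ = ‖A‖ := by
  rw [← conjTranspose_eq_transpose_of_trivial, l2_opNorm_conjTranspose]

lemma opNorm_one_le {n : ℕ} : ‖(1 : Matrix (Fin n) (Fin n) ℝ)‖ ≤ 1 :=
  opNorm_le_of_forall _ zero_le_one fun v => by simp

lemma opNorm_le_one_of_transpose_mul_self {m n : ℕ} {P : Matrix (Fin m) (Fin n) ℝ}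
    (hP : Pᵀ * P = 1) : ‖P‖ ≤ 1 := by
  have h := l2_opNorm_conjTranspose_mul_self P
  rw [conjTranspose_eq_transpose_of_trivial, hP] at h
  have := @opNorm_one_le n
  nlinarith [norm_nonneg P]

/-- A uniform entrywise bound gives a bound of the operator norm. -/
lemma exists_opNorm_le_mul {m n : ℕ} : ∃ K : ℝ,
    ∀ (A : Matrix (Fin m) (Fin n) ℝ) (c : ℝ), (∀ i j, |A i j| ≤ c) → ‖A‖ ≤ K * c := by
  refine ⟨∑ i, ∑ j, ‖(single i j 1 : Matrix (Fin m) (Fin n) ℝ)‖, ?_⟩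
  intro A c h
  calc ‖A‖ = ‖∑ i, ∑ j, A i j • (single i j 1 : Matrix (Fin m) (Fin n) ℝ)‖ := by
        conv_lhs => rw [matrix_eq_sum_single A]
        simp [smul_single]
    _ ≤ ∑ i, ∑ j, ‖A i j • (single i j 1 : Matrix (Fin m) (Fin n) ℝ)‖ :=
        (norm_sum_le _ _).trans (Finset.sum_le_sum fun i _ => norm_sum_le _ _)
    _ ≤ ∑ i, ∑ j, ‖(single i j 1 : Matrix (Fin m) (Fin n) ℝ)‖ * c := by
        refine Finset.sum_le_sum fun i _ => Finset.sum_le_sum fun j _ => ?_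
        rw [norm_smul, mul_comm]
        exact mul_le_mul_of_nonneg_left (h i j) (norm_nonneg _)
    _ = _ := by simp [Finset.sum_mul]

lemma abs_apply_le_frobNorm {m n : ℕ} (A : Matrix (Fin m) (Fin n) ℝ) (i : Fin m) (j : Fin n) :
    |A i j| ≤ frobNorm A := by
  refine Real.abs_le_sqrt ?_
  have h1 : A i j * A i j ≤ ∑ j', A i j' * A i j' :=
    Finset.single_le_sum (f := fun j' => A i j' * A i j') (fun _ _ => mul_self_nonneg _)
      (Finset.mem_univ j)
  have h2 : ∑ j', A i j' * A i j' ≤ frobInner A A :=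
    Finset.single_le_sum (f := fun i' => ∑ j', A i' j' * A i' j')
      (fun _ _ => Finset.sum_nonneg fun _ _ => mul_self_nonneg _) (Finset.mem_univ i)
  rw [sq]
  exact h1.trans h2

/-! ### Duality between the nuclear norm and the operator norm -/

/-- The basis consists of right singular vectors, that is, eigenvectors of the adjoint of `A`
composed with `A`. -/
lemma exists_orthonormalBasis_nuclearNorm {m n : ℕ} (A : Matrix (Fin m) (Fin n) ℝ) :
    ∃ b : OrthonormalBasis (Fin n) ℝ (EuclideanSpace ℝ (Fin n)),
      nuclearNorm A = ∑ i, ‖toEuclideanLin A (b i)‖ ∧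
      ∀ i j, i ≠ j → inner ℝ (toEuclideanLin A (b i)) (toEuclideanLin A (b j)) = 0 := by
  set T := toEuclideanLin A with hT
  have hn : Module.finrank ℝ (EuclideanSpace ℝ (Fin n)) = n := by simp
  set b := T.isSymmetric_adjoint_comp_self.eigenvectorBasis hn with hb
  have hin : ∀ i j, inner ℝ (T (b i)) (T (b j)) =
      T.isSymmetric_adjoint_comp_self.eigenvalues hn j * inner ℝ (b i) (b j) := by
    intro i j
    rw [← LinearMap.adjoint_inner_right, ← LinearMap.comp_apply, hb,
      LinearMap.IsSymmetric.apply_eigenvectorBasis, inner_smul_right]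
    rfl
  refine ⟨b, ?_, fun i j hij => ?_⟩
  · have hs : ∀ i : Fin n, T.singularValues i = ‖T (b i)‖ := by
      intro i
      have h1 := T.sq_singularValues_fin hn i
      have h2 := hin i i
      rw [real_inner_self_eq_norm_sq, real_inner_self_eq_norm_sq, b.norm_eq_one, ← h1] at h2
      have := T.singularValues_nonneg i
      refine (sq_eq_sq₀ this (norm_nonneg _)).1 ?_
      linarith
    rw [nuclearNorm, ← hT, Finsupp.sum_of_support_subset (s := Finset.range n)]
    · rw [Finset.sum_range]
      exact Finset.sum_congr rfl fun i _ => hs i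
    · intro k hk
      by_contra hkn
      rw [Finset.mem_range, not_lt] at hkn
      exact Finsupp.mem_support_iff.1 hk (T.singularValues_of_finrank_le (by rwa [hn]))
    · simp
  · rw [hin, b.orthonormal.2 hij, mul_zero]

lemma frobInner_le_nuclearNorm {m n : ℕ} {G : Matrix (Fin m) (Fin n) ℝ} (hG : ‖G‖ ≤ 1)
    (A : Matrix (Fin m) (Fin n) ℝ) : frobInner G A ≤ nuclearNorm A := by
  obtain ⟨b, hb, -⟩ := exists_orthonormalBasis_nuclearNorm A
  rw [frobInner_eq_sum_inner G A b, hb]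
  refine Finset.sum_le_sum fun i _ => (real_inner_le_norm _ _).trans ?_
  have h := norm_toEuclideanLin_le G (b i)
  rw [b.norm_eq_one, mul_one] at h
  exact mul_le_of_le_one_left (norm_nonneg _) (h.trans hG)

/-- The dual certificate is the partial isometry of the polar decomposition: it normalizes each `T
(b i)`, with the convention `0⁻¹ = 0` covering the kernel. -/
lemma exists_opNorm_le_one_frobInner_eq {m n : ℕ} (A : Matrix (Fin m) (Fin n) ℝ) :
    ∃ C : Matrix (Fin m) (Fin n) ℝ, ‖C‖ ≤ 1 ∧ frobInner C A = nuclearNorm A := by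
  obtain ⟨b, hb, horth⟩ := exists_orthonormalBasis_nuclearNorm A
  set T := toEuclideanLin A with hT
  let u : Fin n → EuclideanSpace ℝ (Fin m) := fun i => ‖T (b i)‖⁻¹ • T (b i)
  let F : EuclideanSpace ℝ (Fin n) →ₗ[ℝ] EuclideanSpace ℝ (Fin m) := b.toBasis.constr ℝ u
  have hFb : ∀ i, F (b i) = u i := fun i => by
    have := b.toBasis.constr_basis ℝ u i
    rwa [b.coe_toBasis] at this
  refine ⟨toEuclideanLin.symm F, ?_, ?_⟩
  · refine opNorm_le_of_forall _ zero_le_one fun v => ?_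
    rw [LinearEquiv.apply_symm_apply, one_mul]
    have hFv : F v = ∑ i, b.repr v i • u i := by
      conv_lhs => rw [← b.sum_repr v]
      simp [hFb]
    have hu : ∀ i, ‖u i‖ ^ 2 ≤ 1 := by
      intro i
      have : ‖u i‖ ≤ 1 := by
        simp only [u, norm_smul, norm_inv, norm_norm]
        exact inv_mul_le_one
      nlinarith [norm_nonneg (u i)]
    have hortho : ∀ i j, i ≠ j → inner ℝ (u i) (u j) = 0 := fun i j hij => by
      simp [u, inner_smul_left, inner_smul_right, horth i j hij]
    have hsq : ‖F v‖ ^ 2 = ∑ i, b.repr v i ^ 2 * ‖u i‖ ^ 2 := by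
      rw [hFv, ← real_inner_self_eq_norm_sq, sum_inner]
      refine Finset.sum_congr rfl fun i _ => ?_
      rw [inner_sum, Finset.sum_eq_single i]
      · rw [inner_smul_left, inner_smul_right, real_inner_self_eq_norm_sq]
        simp only [conj_trivial]
        ring
      · intro j _ hji
        rw [inner_smul_left, inner_smul_right, hortho i j hji.symm]
        simp
      · simp
    have hv : ‖v‖ ^ 2 = ∑ i, b.repr v i ^ 2 := by
      rw [← b.repr.norm_map v, EuclideanSpace.norm_sq_eq]
      simp
    refine le_of_sq_le_sq ?_ (norm_nonneg _)
    rw [hsq, hv]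
    exact Finset.sum_le_sum fun i _ => mul_le_of_le_one_right (sq_nonneg _) (hu i)
  · rw [frobInner_eq_sum_inner _ _ b, hb]
    refine Finset.sum_congr rfl fun i _ => ?_
    rw [LinearEquiv.apply_symm_apply, hFb, ← hT]
    simp only [u, inner_smul_left, real_inner_self_eq_norm_sq, conj_trivial]
    by_cases h : ‖T (b i)‖ = 0
    · simp [h]
    · field_simp

lemma mem_convexSubdiff_nuclearNorm {m n : ℕ} {G X : Matrix (Fin m) (Fin n) ℝ}
    (hG : ‖G‖ ≤ 1) (hGX : nuclearNorm X ≤ frobInner G X) :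
    G ∈ convexSubdiff nuclearNorm X := by
  intro Z
  rw [frobInner_sub_right]
  linarith [frobInner_le_nuclearNorm hG Z]

/-! ### Singular value thresholding -/

lemma opNorm_mul_mul_le_one {k l m n : ℕ} {A : Matrix (Fin k) (Fin l) ℝ}
    {B : Matrix (Fin l) (Fin m) ℝ} {C : Matrix (Fin m) (Fin n) ℝ} (hA : ‖A‖ ≤ 1) (hB : ‖B‖ ≤ 1)
    (hC : ‖C‖ ≤ 1) : ‖A * B * C‖ ≤ 1 := by
  have h1 : ‖A * B‖ ≤ 1 :=
    (l2_opNorm_mul A B).trans (mul_le_one₀ hA (norm_nonneg _) hB)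
  exact (l2_opNorm_mul _ C).trans (mul_le_one₀ h1 (norm_nonneg _) hC)

/-- Duality avoids matching `s` with the singular values: pairing with a contraction `C` weights
each `s i` by a diagonal entry of the contraction `Qᵀ * Cᵀ * P`. -/
lemma nuclearNorm_mul_diagonal_mul_le {m n r : ℕ} {P : Matrix (Fin m) (Fin r) ℝ}
    {Q : Matrix (Fin n) (Fin r) ℝ} {s : Fin r → ℝ} (hP : Pᵀ * P = 1) (hQ : Qᵀ * Q = 1)
    (hs : ∀ i, 0 ≤ s i) : nuclearNorm (P * diagonal s * Qᵀ) ≤ ∑ i, s i := by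
  obtain ⟨C, hC, hCX⟩ := exists_opNorm_le_one_frobInner_eq (P * diagonal s * Qᵀ)
  have hM : ‖Qᵀ * Cᵀ * P‖ ≤ 1 := by
    refine opNorm_mul_mul_le_one ?_ ?_ (opNorm_le_one_of_transpose_mul_self hP)
    · exact (opNorm_transpose Q).trans_le (opNorm_le_one_of_transpose_mul_self hQ)
    · exact (opNorm_transpose C).trans_le hC
  have h1 : Cᵀ * (P * diagonal s * Qᵀ) = (Cᵀ * P * diagonal s) * Qᵀ := by
    simp only [Matrix.mul_assoc]
  have h2 : Qᵀ * (Cᵀ * P * diagonal s) = (Qᵀ * Cᵀ * P) * diagonal s := by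
    simp only [Matrix.mul_assoc]
  rw [← hCX, frobInner_eq_trace, h1, trace_mul_comm, h2]
  simp only [trace, diag_apply, mul_diagonal]
  exact Finset.sum_le_sum fun i _ => mul_le_of_le_one_left (hs i)
    ((le_abs_self _).trans ((abs_apply_le_opNorm _ i i).trans hM))

lemma frobInner_mul_diagonal_mul {m n r : ℕ} {P : Matrix (Fin m) (Fin r) ℝ}
    {Q : Matrix (Fin n) (Fin r) ℝ} (w s : Fin r → ℝ) (hP : Pᵀ * P = 1) (hQ : Qᵀ * Q = 1) :
    frobInner (P * diagonal w * Qᵀ) (P * diagonal s * Qᵀ) = ∑ i, w i * s i := by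
  have h : (P * diagonal w * Qᵀ)ᵀ * (P * diagonal s * Qᵀ) =
      Q * (diagonal w * (Pᵀ * P) * diagonal s * Qᵀ) := by
    simp only [transpose_mul, transpose_transpose, diagonal_transpose, Matrix.mul_assoc]
  rw [frobInner_eq_trace, h, trace_mul_comm, Matrix.mul_assoc, hQ, hP, Matrix.mul_one,
    Matrix.mul_one, diagonal_mul_diagonal, trace_diagonal]

lemma IsSVT.exists_dual {m n : ℕ} {τ : ℝ} (hτ : 0 < τ) {Y X : Matrix (Fin m) (Fin n) ℝ}
    (h : IsSVT τ Y X) :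
    ∃ G : Matrix (Fin m) (Fin n) ℝ, ‖G‖ ≤ 1 ∧ nuclearNorm X ≤ frobInner G X ∧
      Y - X = τ • G := by
  obtain ⟨r, P, Q, σ, hP, hQ, hσ, rfl, rfl⟩ := h
  obtain ⟨s, hs⟩ : ∃ s : Fin r → ℝ, s = fun i => max (σ i - τ) 0 := ⟨_, rfl⟩
  -- Here `w i = min (σ i) τ / τ`: it lies in [0, 1] and equals 1 wherever the shrunken value `s i`
  -- is positive.
  obtain ⟨w, hw⟩ : ∃ w : Fin r → ℝ, ∀ i, w i = (σ i - s i) / τ := ⟨_, fun _ => rfl⟩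
  have hsi : ∀ i, s i = max (σ i - τ) 0 := fun i => by rw [hs]
  rw [← hs]
  have hw1 : ‖w‖ ≤ 1 := by
    refine (pi_norm_le_iff_of_nonneg zero_le_one).2 fun i => ?_
    rw [Real.norm_eq_abs, abs_le, hw, hsi, le_div_iff₀ hτ, div_le_one hτ]
    constructor
    · rcases max_cases (σ i - τ) 0 with h | h <;> linarith [hσ i]
    · linarith [le_max_left (σ i - τ) 0]
  have hws : ∀ i, w i * s i = s i := by
    intro i
    rw [hw, hsi]
    rcases max_cases (σ i - τ) 0 with h | h
    · rw [h.1, sub_sub_cancel, div_self hτ.ne', one_mul]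
    · rw [h.1, mul_zero]
  refine ⟨P * diagonal w * Qᵀ, ?_, ?_, ?_⟩
  · refine opNorm_mul_mul_le_one (opNorm_le_one_of_transpose_mul_self hP) ?_
      ((opNorm_transpose Q).trans_le (opNorm_le_one_of_transpose_mul_self hQ))
    rwa [l2_opNorm_diagonal]
  · rw [frobInner_mul_diagonal_mul w s hP hQ]
    simp only [hws]
    exact nuclearNorm_mul_diagonal_mul_le hP hQ fun i => by rw [hsi]; exact le_max_right _ _
  · rw [← Matrix.sub_mul, ← Matrix.mul_sub, ← Matrix.smul_mul, ← Matrix.mul_smul,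
      diagonal_sub, ← diagonal_smul]
    congr 3
    funext i
    rw [Pi.smul_apply, smul_eq_mul, hw, mul_div_cancel₀ _ hτ.ne']

end OperatorNorm

/-! ### Closedness of the subdifferential of the nuclear norm -/

lemma tendsto_frobInner {m n : ℕ} {A B : Matrix (Fin m) (Fin n) ℝ}
    {a b : ℕ → Matrix (Fin m) (Fin n) ℝ} (ha : Tendsto a atTop (𝓝 A))
    (hb : Tendsto b atTop (𝓝 B)) :
    Tendsto (fun k => frobInner (a k) (b k)) atTop (𝓝 (frobInner A B)) := by
  unfold frobInner
  exact tendsto_finsetSum _ fun i _ => tendsto_finsetSum _ fun j _ =>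
    ((ha.apply_nhds i).apply_nhds j).mul ((hb.apply_nhds i).apply_nhds j)

/-- Only lower semicontinuity of the nuclear norm is needed. It comes from a certificate `C` for the
limit `X`, since `frobInner C (x k)` bounds the nuclear norm of `x k` from below. -/
lemma mem_convexSubdiff_nuclearNorm_of_tendsto {m n : ℕ} {G X : Matrix (Fin m) (Fin n) ℝ}
    {g x : ℕ → Matrix (Fin m) (Fin n) ℝ} (hg : Tendsto g atTop (𝓝 G))
    (hx : Tendsto x atTop (𝓝 X)) (h : ∀ᶠ k in atTop, g k ∈ convexSubdiff nuclearNorm (x k)) :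
    G ∈ convexSubdiff nuclearNorm X := by
  intro Z
  obtain ⟨C, hC, hCX⟩ := exists_opNorm_le_one_frobInner_eq X
  rw [← hCX]
  have h1 := (tendsto_frobInner (tendsto_const_nhds (x := C)) hx).add
    (tendsto_frobInner hg ((tendsto_const_nhds (x := Z)).sub hx))
  exact le_of_tendsto h1 (h.mono fun k hk =>
    (add_le_add_left (frobInner_le_nuclearNorm hC _) _).trans (hk Z))

/-! ### The scalar half-thresholding operator -/

/-- The derivative of `|s| ^ (1 / 2)` at `s ≠ 0`, with value `0` at `s = 0`. -/
noncomputable def halfGrad (s : ℝ) : ℝ := Real.sign s / (2 * √|s|)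

lemma halfGrad_neg (s : ℝ) : halfGrad (-s) = -halfGrad s := by
  simp [halfGrad, Real.sign_neg, neg_div]

lemma halfThreshold_neg (γ a : ℝ) : halfThreshold γ (-a) = -halfThreshold γ a := by
  unfold halfThreshold
  rw [abs_neg]
  split_ifs <;> ring

lemma rpow_cbrt_pow {x : ℝ} (hx : 0 ≤ x) : (x ^ (1 / 3 : ℝ)) ^ 3 = x := by
  rw [← Real.rpow_natCast, ← Real.rpow_mul hx]
  norm_num

/-- The threshold is about 0.945 γ^(2/3). The lower bound keeps the argument of the arccosine at
most 1; the upper bound controls the displacement of inputs that are sent to 0. -/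
lemma threshold_bounds {γ : ℝ} (hγ : 0 < γ) :
    3 / 4 * (γ ^ (1 / 3 : ℝ)) ^ 2 ≤ (54 * γ ^ 2) ^ (1 / 3 : ℝ) / 4 ∧
      (54 * γ ^ 2) ^ (1 / 3 : ℝ) / 4 ≤ (γ ^ (1 / 3 : ℝ)) ^ 2 := by
  have hg := rpow_cbrt_pow hγ.le
  have hT := rpow_cbrt_pow (x := 54 * γ ^ 2) (by positivity)
  have hg0 : 0 < γ ^ (1 / 3 : ℝ) := by positivity
  have hT0 : 0 < (54 * γ ^ 2) ^ (1 / 3 : ℝ) := by positivity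
  generalize (54 * γ ^ 2) ^ (1 / 3 : ℝ) = T at *
  generalize γ ^ (1 / 3 : ℝ) = g at *
  subst hg
  constructor
  · have : 3 * g ^ 2 ≤ T := by
      refine le_of_pow_le_pow_left₀ (n := 3) (by norm_num) hT0.le ?_
      rw [hT]
      nlinarith [pow_pos hg0 6]
    linarith
  · have : T ≤ 4 * g ^ 2 := by
      refine le_of_pow_le_pow_left₀ (n := 3) (by norm_num) (by positivity) ?_
      rw [hT]
      nlinarith [pow_pos hg0 6]
    linarith

/-- Above the threshold, half-thresholding returns a stationary point of
`s ↦ (s - a) ^ 2 + γ * |s| ^ (1 / 2)`. -/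
lemma halfThreshold_spec_of_pos {γ a : ℝ} (hγ : 0 < γ) (ha : 0 < a)
    (h : (54 * γ ^ 2) ^ (1 / 3 : ℝ) / 4 < |a|) :
    0 < halfThreshold γ a ∧ a - halfThreshold γ a = γ / 2 * halfGrad (halfThreshold γ a) ∧
      |a - halfThreshold γ a| ≤ (γ ^ (1 / 3 : ℝ)) ^ 2 := by
  have hag : 3 / 4 * (γ ^ (1 / 3 : ℝ)) ^ 2 < a := by
    rw [abs_of_pos ha] at h
    exact (threshold_bounds hγ).1.trans_lt h
  have hg := rpow_cbrt_pow hγ.le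
  have hg0 : 0 < γ ^ (1 / 3 : ℝ) := by positivity
  rw [halfThreshold, if_pos h, abs_of_pos ha]
  generalize γ ^ (1 / 3 : ℝ) = g at *
  -- With `a = 3 * r ^ 2`, the arccosine argument becomes γ / (8 r³) and the output a perfect
  -- square, (2qr)².
  obtain ⟨r, hr0, hra⟩ : ∃ r : ℝ, 0 < r ∧ a = 3 * r ^ 2 :=
    ⟨√(a / 3), by positivity, by rw [Real.sq_sqrt (by positivity)]; ring⟩
  have hgr : g / 2 < r := by nlinarith
  have hrp : (a / 3) ^ (-(3 / 2) : ℝ) = (r ^ 3)⁻¹ := by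
    rw [hra, mul_div_cancel_left₀ _ (by norm_num : (3 : ℝ) ≠ 0), ← Real.rpow_natCast r 2,
      ← Real.rpow_mul hr0.le, ← Real.rpow_natCast r 3, ← Real.rpow_neg hr0.le]
    norm_num
  rw [hrp]
  have hx1 : γ / 8 * (r ^ 3)⁻¹ ≤ 1 := by
    rw [← div_eq_mul_inv, div_le_one (by positivity), ← hg]
    have : (g / 2) ^ 3 ≤ r ^ 3 := by gcongr
    linarith [show (g / 2) ^ 3 = g ^ 3 / 8 by ring]
  have hx0 : 0 ≤ γ / 8 * (r ^ 3)⁻¹ := by positivity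
  have hcos := Real.cos_arccos (by linarith) hx1
  have hφ0 := Real.arccos_nonneg (γ / 8 * (r ^ 3)⁻¹)
  have hφ1 := Real.arccos_le_pi_div_two.2 hx0
  generalize Real.arccos (γ / 8 * (r ^ 3)⁻¹) = φ at *
  obtain ⟨q, hq⟩ : ∃ q, q = Real.cos ((Real.pi - φ) / 3) := ⟨_, rfl⟩
  have hq12 : 1 / 2 ≤ q := by
    rw [hq, ← Real.cos_pi_div_three]
    apply Real.cos_le_cos_of_nonneg_of_le_pi <;> linarith [Real.pi_pos]
  have hc : Real.cos ((2 * Real.pi - 2 * φ) / 3) = 2 * q ^ 2 - 1 := by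
    rw [hq, ← Real.cos_two_mul]
    congr 1
    ring
  -- The triple-angle formula turns the trigonometric expression into the cubic that encodes
  -- stationarity.
  have hq3 : 3 * q - 4 * q ^ 3 = γ / 8 * (r ^ 3)⁻¹ := by
    have := Real.cos_three_mul ((Real.pi - φ) / 3)
    rw [← hq, mul_div_cancel₀ _ (by norm_num : (3 : ℝ) ≠ 0), Real.cos_pi_sub, hcos] at this
    linarith
  have hs : 2 / 3 * a * (1 + (2 * q ^ 2 - 1)) = (2 * q * r) ^ 2 := by rw [hra]; ring
  rw [hc, hs]
  have hq0 : 0 < q := by linarith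
  have hstat : a - (2 * q * r) ^ 2 = γ / (8 * q * r) := by
    rw [← div_eq_mul_inv, div_div, eq_div_iff (by positivity)] at hq3
    rw [eq_div_iff (by positivity), hra]
    linear_combination hq3
  have hpos : 0 < (2 * q * r) ^ 2 := by positivity
  refine ⟨hpos, ?_, ?_⟩
  · rw [hstat, halfGrad, Real.sign_of_pos hpos, abs_of_pos hpos, Real.sqrt_sq (by positivity)]
    field_simp
    norm_num
  · rw [hstat, abs_of_nonneg (by positivity), div_le_iff₀ (by positivity), ← hg]
    have h1 : g / 4 ≤ q * r := by nlinarith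
    nlinarith [mul_le_mul_of_nonneg_left h1 (sq_nonneg g), pow_pos hg0 3]

lemma halfThreshold_spec {γ : ℝ} (hγ : 0 < γ) (a : ℝ) :
    (halfThreshold γ a ≠ 0 → a - halfThreshold γ a = γ / 2 * halfGrad (halfThreshold γ a)) ∧
      |a - halfThreshold γ a| ≤ (γ ^ (1 / 3 : ℝ)) ^ 2 := by
  by_cases h : (54 * γ ^ 2) ^ (1 / 3 : ℝ) / 4 < |a|
  · have ha : a ≠ 0 := by
      rintro rfl
      rw [abs_zero] at h
      exact absurd h (not_lt.2 (by positivity))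
    rcases lt_or_gt_of_ne ha with ha | ha
    · obtain ⟨-, h2, h3⟩ := halfThreshold_spec_of_pos hγ (neg_pos.2 ha) (by rwa [abs_neg])
      rw [halfThreshold_neg, halfGrad_neg] at h2
      rw [halfThreshold_neg, ← neg_sub_neg, neg_neg, neg_neg, abs_sub_comm] at h3
      exact ⟨fun _ => by linarith, h3⟩
    · obtain ⟨-, h2, h3⟩ := halfThreshold_spec_of_pos hγ ha h
      exact ⟨fun _ => h2, h3⟩
  · have h0 : halfThreshold γ a = 0 := if_neg h
    rw [h0]
    refine ⟨fun h => absurd rfl h, ?_⟩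
    rw [sub_zero]
    exact (not_lt.1 h).trans (threshold_bounds hγ).2

/-! ### The subdifferential of the penalty -/

lemma hasDerivAt_abs_rpow_half {s : ℝ} (hs : s ≠ 0) :
    HasDerivAt (fun z : ℝ => |z| ^ (1 / 2 : ℝ)) (halfGrad s) s := by
  have h1 : (fun z : ℝ => |z| ^ (1 / 2 : ℝ)) = fun z => √|z| := by
    funext z
    rw [Real.sqrt_eq_rpow]
  rw [h1, halfGrad]
  have h2 : HasDerivAt (fun z : ℝ => |z|) (Real.sign s) s := by
    rcases lt_or_gt_of_ne hs with h | h
    · rw [Real.sign_of_neg h]; exact hasDerivAt_abs_neg h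
    · rw [Real.sign_of_pos h]; exact hasDerivAt_abs_pos h
  exact h2.sqrt (abs_ne_zero.2 hs)

/-- At `s = 0` any slope `g` is allowed, because |g z| ≤ √|z| as soon as |g| √|z| ≤ 1. Elsewhere
this is differentiability. -/
lemma eventually_abs_rpow_half_ge {s g : ℝ} (hg : s ≠ 0 → g = halfGrad s) {ε : ℝ} (hε : 0 < ε) :
    ∀ᶠ z in 𝓝 s, |s| ^ (1 / 2 : ℝ) + g * (z - s) - ε * |z - s| ≤ |z| ^ (1 / 2 : ℝ) := by
  by_cases hs : s = 0
  · subst hs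
    have hc : Tendsto (fun z : ℝ => |g| * √|z|) (𝓝 0) (𝓝 0) := by
      have : Continuous fun z : ℝ => |g| * √|z| := by fun_prop
      simpa using this.tendsto 0
    filter_upwards [hc.eventually (gt_mem_nhds one_pos)] with z hz
    rw [abs_zero, Real.zero_rpow (by norm_num), ← Real.sqrt_eq_rpow, sub_zero, zero_add]
    have h1 : g * z ≤ |g| * |z| := (le_abs_self _).trans (abs_mul g z).le
    have h2 : |g| * |z| = (|g| * √|z|) * √|z| := by
      rw [mul_assoc, Real.mul_self_sqrt (abs_nonneg z)]
    have h3 : (|g| * √|z|) * √|z| ≤ √|z| := mul_le_of_le_one_left (Real.sqrt_nonneg _) hz.le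
    have h4 : 0 ≤ ε * |z| := by positivity
    linarith
  · have h := (hasDerivAt_abs_rpow_half hs).isLittleO.def hε
    rw [hg hs]
    filter_upwards [h] with z hz
    rw [Real.norm_eq_abs, Real.norm_eq_abs, smul_eq_mul] at hz
    have := (abs_le.1 hz).1
    linarith [mul_comm (halfGrad s) (z - s)]

lemma mem_frechetSubdiff_Phi {m n : ℕ} {Ω : Set (Fin m × Fin n)}
    {G S : Matrix (Fin m) (Fin n) ℝ} (hoff : ∀ i j, (i, j) ∉ Ω → G i j = 0)
    (hon : ∀ i j, (i, j) ∈ Ω → S i j ≠ 0 → G i j = halfGrad (S i j)) :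
    G ∈ frechetSubdiff (Phi Ω) S := by
  intro ε hε
  obtain ⟨δ, hδ0, hδ⟩ : ∃ δ : ℝ, 0 < δ ∧ m * n * δ ≤ ε := by
    -- The error `ε` is shared among the `m * n` entries; the `+ 1` covers empty matrices.
    refine ⟨ε / (m * n + 1), by positivity, ?_⟩
    rw [← mul_div_assoc, div_le_iff₀ (by positivity)]
    nlinarith
  have hcoord : ∀ i j, ∀ᶠ Z : Matrix (Fin m) (Fin n) ℝ in 𝓝 S,
      |proj Ω S i j| ^ (1 / 2 : ℝ) + G i j * (Z i j - S i j) - δ * |Z i j - S i j| ≤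
        |proj Ω Z i j| ^ (1 / 2 : ℝ) := by
    intro i j
    by_cases hij : (i, j) ∈ Ω
    · have hc : Tendsto (fun Z : Matrix (Fin m) (Fin n) ℝ => Z i j) (𝓝 S) (𝓝 (S i j)) :=
        (continuous_id.matrix_elem i j).tendsto S
      simp only [proj, of_apply, if_pos hij]
      exact hc.eventually (eventually_abs_rpow_half_ge (hon i j hij) hδ0)
    · refine Eventually.of_forall fun Z => ?_
      simp only [proj, of_apply, if_neg hij, hoff i j hij]
      have : 0 ≤ δ * |Z i j - S i j| := by positivity
      linarith
  filter_upwards [eventually_all.2 fun i => eventually_all.2 (hcoord i)] with Z hZ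
  have h1 := Finset.sum_le_sum fun i (_ : i ∈ Finset.univ) =>
    Finset.sum_le_sum fun j (_ : j ∈ Finset.univ) => hZ i j
  simp only [Finset.sum_add_distrib, Finset.sum_sub_distrib] at h1
  have h2 : ∑ i, ∑ j, δ * |Z i j - S i j| ≤ ε * frobNorm (Z - S) := by
    calc ∑ i, ∑ j, δ * |Z i j - S i j| ≤ ∑ i : Fin m, ∑ j : Fin n, δ * frobNorm (Z - S) :=
          Finset.sum_le_sum fun i _ => Finset.sum_le_sum fun j _ =>
            mul_le_mul_of_nonneg_left (abs_apply_le_frobNorm (Z - S) i j) hδ0.le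
      _ = m * n * δ * frobNorm (Z - S) := by
          simp only [Finset.sum_const, Finset.card_univ, Fintype.card_fin, nsmul_eq_mul]
          ring
      _ ≤ _ := mul_le_mul_of_nonneg_right hδ (Real.sqrt_nonneg _)
  have h3 : frobInner G (Z - S) = ∑ i, ∑ j, G i j * (Z i j - S i j) := rfl
  rw [h3]
  unfold Phi
  linarith

lemma frechetSubdiff_subset_limitingSubdiff {m n : ℕ} (f : Matrix (Fin m) (Fin n) ℝ → ℝ)
    (X : Matrix (Fin m) (Fin n) ℝ) : frechetSubdiff f X ⊆ limitingSubdiff f X := fun G hG =>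
  ⟨fun _ => X, fun _ => G, tendsto_const_nhds, tendsto_const_nhds, fun _ => hG,
    tendsto_const_nhds⟩

lemma proj_apply_mem {m n : ℕ} {Ω : Set (Fin m × Fin n)} (A : Matrix (Fin m) (Fin n) ℝ)
    {i : Fin m} {j : Fin n} (h : (i, j) ∈ Ω) : proj Ω A i j = A i j := by
  simp [proj, h]

lemma proj_apply_notMem {m n : ℕ} {Ω : Set (Fin m × Fin n)} (A : Matrix (Fin m) (Fin n) ℝ)
    {i : Fin m} {j : Fin n} (h : (i, j) ∉ Ω) : proj Ω A i j = 0 := by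
  simp [proj, h]

lemma exists_limitingSubdiff_Phi_add_eq_zero {m n : ℕ} {Ω : Set (Fin m × Fin n)}
    {Y S : Matrix (Fin m) (Fin n) ℝ}
    (h : ∀ i j, (i, j) ∈ Ω → S i j ≠ 0 → Y i j = -halfGrad (S i j)) :
    ∃ G ∈ limitingSubdiff (Phi Ω) S, G + proj Ω Y = 0 := by
  refine ⟨-proj Ω Y, frechetSubdiff_subset_limitingSubdiff _ _ ?_, neg_add_cancel _⟩
  refine mem_frechetSubdiff_Phi (fun i j hij => ?_) fun i j hij hS => ?_
  · rw [neg_apply, proj_apply_notMem Y hij, neg_zero]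
  · rw [neg_apply, proj_apply_mem Y hij, h i j hij hS, neg_neg]

section Estimates

open scoped Matrix.Norms.L2Operator

/-! ### Regularized least squares -/

lemma isUnit_one_add_transpose_mul_self {n d : ℕ} (V : Matrix (Fin n) (Fin d) ℝ) :
    IsUnit (1 + Vᵀ * V) := by
  have h : (Vᵀ * V).PosSemidef := by
    rw [← conjTranspose_eq_transpose_of_trivial]
    exact posSemidef_conjTranspose_mul_self V
  exact (PosDef.one.add_posSemidef h).isUnit

lemma norm_sq_add_norm_sq_eq_inner {n d : ℕ} (V : Matrix (Fin n) (Fin d) ℝ)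
    (v : EuclideanSpace ℝ (Fin d)) :
    ‖v‖ ^ 2 + ‖toEuclideanLin V v‖ ^ 2 = inner ℝ (toEuclideanLin (1 + Vᵀ * V) v) v := by
  rw [← real_inner_self_eq_norm_sq, ← real_inner_self_eq_norm_sq]
  simp only [EuclideanSpace.inner_eq_star_dotProduct, toLpLin_apply, star_trivial, add_mulVec,
    one_mulVec, dotProduct_add, ← mulVec_mulVec]
  congr 1
  rw [mulVec_transpose, dotProduct_comm v.ofLp, ← dotProduct_mulVec]

/-- If `v` solves (1 + VᵀV) v = y, then ‖v‖² + ‖Vv‖² = ⟨y, v⟩ ≤ ‖y‖ ‖v‖, which bounds ‖v‖ and then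
‖Vv‖ by ‖y‖. -/
lemma opNorm_inv_one_add_le {n d : ℕ} (V : Matrix (Fin n) (Fin d) ℝ) :
    ‖(1 + Vᵀ * V)⁻¹‖ ≤ 1 ∧ ‖V * (1 + Vᵀ * V)⁻¹‖ ≤ 1 := by
  have hdet := (isUnit_iff_isUnit_det _).1 (isUnit_one_add_transpose_mul_self V)
  have key : ∀ y : EuclideanSpace ℝ (Fin d), ‖toEuclideanLin (1 + Vᵀ * V)⁻¹ y‖ ≤ ‖y‖ ∧
      ‖toEuclideanLin (V * (1 + Vᵀ * V)⁻¹) y‖ ≤ ‖y‖ := by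
    intro y
    have h1 : toEuclideanLin (V * (1 + Vᵀ * V)⁻¹) y =
        toEuclideanLin V (toEuclideanLin (1 + Vᵀ * V)⁻¹ y) := by
      simp [toLpLin_apply]
    have h2 : toEuclideanLin (1 + Vᵀ * V) (toEuclideanLin (1 + Vᵀ * V)⁻¹ y) = y := by
      rw [toLpLin_apply, toLpLin_apply, mulVec_mulVec, mul_nonsing_inv _ hdet, one_mulVec]
    rw [h1]
    have h3 := norm_sq_add_norm_sq_eq_inner V (toEuclideanLin (1 + Vᵀ * V)⁻¹ y)
    rw [h2] at h3
    have h4 := real_inner_le_norm y (toEuclideanLin (1 + Vᵀ * V)⁻¹ y)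
    have h5 := norm_nonneg (toEuclideanLin (1 + Vᵀ * V)⁻¹ y)
    have h6 := norm_nonneg (toEuclideanLin V (toEuclideanLin (1 + Vᵀ * V)⁻¹ y))
    have h7 := norm_nonneg y
    generalize ‖toEuclideanLin V (toEuclideanLin (1 + Vᵀ * V)⁻¹ y)‖ = b at *
    generalize ‖toEuclideanLin (1 + Vᵀ * V)⁻¹ y‖ = a at *
    have h8 : a ≤ ‖y‖ := by
      by_contra hlt
      push Not at hlt
      nlinarith
    exact ⟨h8, by nlinarith⟩
  exact ⟨opNorm_le_of_forall _ zero_le_one fun y => by rw [one_mul]; exact (key y).1,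
    opNorm_le_of_forall _ zero_le_one fun y => by rw [one_mul]; exact (key y).2⟩

/-- The regularized least squares solution moves away from `U` at most by the size of the
residuals at `U`, whatever the size of `V`. -/
lemma opNorm_leastSquares_sub_le {m n d : ℕ} (A U : Matrix (Fin m) (Fin d) ℝ)
    (M : Matrix (Fin m) (Fin n) ℝ) (V : Matrix (Fin n) (Fin d) ℝ) :
    ‖(A + M * V) * (1 + Vᵀ * V)⁻¹ - U‖ ≤ ‖A - U‖ + ‖M - U * Vᵀ‖ := by
  have hdet := (isUnit_iff_isUnit_det _).1 (isUnit_one_add_transpose_mul_self V)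
  -- Writing `U` as `U * (1 + Vᵀ * V) * (1 + Vᵀ * V)⁻¹` exposes the two residuals, each multiplied
  -- by a contraction.
  have h1 : (A + M * V) * (1 + Vᵀ * V)⁻¹ - U =
      (A - U) * (1 + Vᵀ * V)⁻¹ + (M - U * Vᵀ) * (V * (1 + Vᵀ * V)⁻¹) := by
    have h2 : U = U * (1 + Vᵀ * V) * (1 + Vᵀ * V)⁻¹ := by
      rw [Matrix.mul_assoc, mul_nonsing_inv _ hdet, Matrix.mul_one]
    conv_lhs => rw [h2]
    rw [← Matrix.sub_mul, ← Matrix.mul_assoc, ← Matrix.add_mul]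
    congr 1
    simp only [Matrix.mul_add, Matrix.sub_mul, Matrix.mul_one, Matrix.mul_assoc]
    abel
  obtain ⟨h3, h4⟩ := opNorm_inv_one_add_le V
  rw [h1]
  refine (norm_add_le _ _).trans (add_le_add ?_ ?_)
  · exact (l2_opNorm_mul _ _).trans (mul_le_of_le_one_right (norm_nonneg _) h3)
  · exact (l2_opNorm_mul _ _).trans (mul_le_of_le_one_right (norm_nonneg _) h4)

/-! ### Estimates for the iterates -/

lemma opNorm_residual_le {m n : ℕ} {Y Y' R : Matrix (Fin m) (Fin n) ℝ} {μ C : ℝ} (hμ : 0 < μ)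
    (hY' : Y' = Y + μ • R) (h : ‖Y‖ ≤ C) (h' : ‖Y'‖ ≤ C) : ‖R‖ ≤ 2 * C * μ⁻¹ := by
  have hR : R = μ⁻¹ • (Y' - Y) := by
    rw [hY', add_sub_cancel_left, smul_smul, inv_mul_cancel₀ hμ.ne', one_smul]
  rw [hR, norm_smul, Real.norm_of_nonneg (by positivity), mul_comm]
  have := norm_sub_le Y' Y
  gcongr
  linarith

lemma opNorm_smul_inv_le {m n : ℕ} {Y : Matrix (Fin m) (Fin n) ℝ} {μ μ' C : ℝ} (hμ : 0 < μ)
    (hμ' : μ ≤ μ') (h : ‖Y‖ ≤ C) : ‖μ'⁻¹ • Y‖ ≤ C * μ⁻¹ := by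
  have hμ'0 : 0 < μ' := hμ.trans_le hμ'
  rw [norm_smul, Real.norm_of_nonneg (by positivity), mul_comm]
  gcongr
  exact (norm_nonneg _).trans h

variable {m n d : ℕ} {Ω : Set (Fin m × Fin n)} {D : Matrix (Fin m) (Fin n) ℝ} {lam μ μ' C : ℝ}
  {x x' x'' : State m n d}

lemma exists_dual_of_isSVT {p q : ℕ} {U Uhat Y Y' : Matrix (Fin p) (Fin q) ℝ} (hlam : 0 < lam)
    (hμ : 0 < μ) (hsvt : IsSVT (lam / (2 * μ)) (U - μ⁻¹ • Y) Uhat)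
    (hY : Y' = Y + μ • (Uhat - U)) :
    ∃ G : Matrix (Fin p) (Fin q) ℝ, ‖G‖ ≤ 1 ∧ nuclearNorm Uhat ≤ frobInner G Uhat ∧
      Y' = -((lam / 2) • G) := by
  obtain ⟨G, h1, h2, h3⟩ := hsvt.exists_dual (by positivity)
  refine ⟨G, h1, h2, ?_⟩
  have h4 : Uhat = U - μ⁻¹ • Y - (lam / (2 * μ)) • G := by rw [← h3, sub_sub_cancel]
  have h5 : μ * (lam / (2 * μ)) = lam / 2 := by field_simp
  rw [hY, h4]
  simp only [smul_sub, smul_smul, h5, mul_inv_cancel₀ hμ.ne', one_smul]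
  abel

lemma ADMMStep.opNorm_Y₁_le (h : ADMMStep Ω D lam μ x x') (hlam : 0 < lam) (hμ : 0 < μ) :
    ‖x'.Y₁‖ ≤ lam / 2 := by
  obtain ⟨G, h1, -, h3⟩ := exists_dual_of_isSVT hlam hμ h.Uhat_svt h.Y₁_eq
  rw [h3, norm_neg, norm_smul, Real.norm_of_nonneg (by positivity)]
  exact mul_le_of_le_one_right (by positivity) h1

lemma ADMMStep.opNorm_Y₂_le (h : ADMMStep Ω D lam μ x x') (hlam : 0 < lam) (hμ : 0 < μ) :
    ‖x'.Y₂‖ ≤ lam / 2 := by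
  obtain ⟨G, h1, -, h3⟩ := exists_dual_of_isSVT hlam hμ h.Vhat_svt h.Y₂_eq
  rw [h3, norm_neg, norm_smul, Real.norm_of_nonneg (by positivity)]
  exact mul_le_of_le_one_right (by positivity) h1

/-- The multipliers `Y₁`, `Y₂`, `Y₃` of the state are bounded by `C` in operator norm. -/
def State.MultipliersLE (C : ℝ) (x : State m n d) : Prop := ‖x.Y₁‖ ≤ C ∧ ‖x.Y₂‖ ≤ C ∧ ‖x.Y₃‖ ≤ C

lemma ADMMStep.opNorm_sub_U_le (h : ADMMStep Ω D lam μ x x') (h' : ADMMStep Ω D lam μ' x' x'')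
    (hμ : 0 < μ) (hμ' : μ ≤ μ') (hx : x.MultipliersLE C) (hx' : x'.MultipliersLE C) :
    ‖x''.U - x'.U‖ ≤ 6 * C * μ⁻¹ := by
  rw [h'.U_eq]
  refine (opNorm_leastSquares_sub_le _ _ _ _).trans ?_
  -- The constant 6 is 2 + 1 + 2 + 1: two residuals and two scaled multipliers.
  have h1 := opNorm_residual_le hμ h.Y₁_eq hx.1 hx'.1
  have h2 := opNorm_smul_inv_le hμ hμ' hx'.1
  have h3 := opNorm_residual_le hμ h.Y₃_eq hx.2.2 hx'.2.2
  have h4 := opNorm_smul_inv_le hμ hμ' hx'.2.2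
  have e1 : x'.Uhat + μ'⁻¹ • x'.Y₁ - x'.U = (x'.Uhat - x'.U) + μ'⁻¹ • x'.Y₁ := by abel
  have e2 : x'.L - μ'⁻¹ • x'.Y₃ - x'.U * x'.Vᵀ =
      -((x'.U * x'.Vᵀ - x'.L) + μ'⁻¹ • x'.Y₃) := by abel
  rw [e1, e2, norm_neg]
  have h5 := norm_add_le (x'.Uhat - x'.U) (μ'⁻¹ • x'.Y₁)
  have h6 := norm_add_le (x'.U * x'.Vᵀ - x'.L) (μ'⁻¹ • x'.Y₃)
  linarith

lemma ADMMStep.opNorm_sub_V_le (h : ADMMStep Ω D lam μ x x') (h' : ADMMStep Ω D lam μ' x' x'')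
    (hμ : 0 < μ) (hμ' : μ ≤ μ') (hx : x.MultipliersLE C) (hx' : x'.MultipliersLE C) :
    ‖x''.V - x'.V‖ ≤ 6 * C * μ⁻¹ * (1 + ‖x'.V‖) := by
  have hU := h.opNorm_sub_U_le h' hμ hμ' hx hx'
  rw [h'.V_eq]
  refine (opNorm_leastSquares_sub_le _ _ _ _).trans ?_
  have h1 := opNorm_residual_le hμ h.Y₂_eq hx.2.1 hx'.2.1
  have h2 := opNorm_smul_inv_le hμ hμ' hx'.2.1
  have h3 := opNorm_residual_le hμ h.Y₃_eq hx.2.2 hx'.2.2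
  have h4 := opNorm_smul_inv_le hμ hμ' hx'.2.2
  have e1 : x'.Vhat + μ'⁻¹ • x'.Y₂ - x'.V = (x'.Vhat - x'.V) + μ'⁻¹ • x'.Y₂ := by abel
  -- The update of `V` already uses the new `U`, so the old residual must be corrected by `(x''.U -
  -- x'.U) * x'.Vᵀ`.
  have e2 : (x'.L - μ'⁻¹ • x'.Y₃)ᵀ - x'.V * x''.Uᵀ =
      (-((x'.U * x'.Vᵀ - x'.L) + μ'⁻¹ • x'.Y₃ + (x''.U - x'.U) * x'.Vᵀ))ᵀ := by
    simp only [transpose_sub, transpose_neg, transpose_add, transpose_mul, transpose_transpose,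
      Matrix.sub_mul]
    abel
  rw [e1, e2, opNorm_transpose, norm_neg]
  have h5 := norm_add_le (x'.Vhat - x'.V) (μ'⁻¹ • x'.Y₂)
  have h6 := norm_add_le (x'.U * x'.Vᵀ - x'.L) (μ'⁻¹ • x'.Y₃)
  have h7 := norm_add_le (x'.U * x'.Vᵀ - x'.L + μ'⁻¹ • x'.Y₃) ((x''.U - x'.U) * x'.Vᵀ)
  have h8 : ‖(x''.U - x'.U) * x'.Vᵀ‖ ≤ 6 * C * μ⁻¹ * ‖x'.V‖ := by
    refine (l2_opNorm_mul _ _).trans ?_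
    rw [opNorm_transpose]
    gcongr
  linarith

end Estimates

/-- The new `Y₄` is `μ` times the displacement made by the update of `S`: zero off `Ω`, that of
half-thresholding on `Ω`. -/
lemma ADMMStep.Y₄_apply {m n d : ℕ} {Ω : Set (Fin m × Fin n)} {D : Matrix (Fin m) (Fin n) ℝ}
    {lam μ : ℝ} {x x' : State m n d} (h : ADMMStep Ω D lam μ x x') (hμ : 0 < μ)
    (i : Fin m) (j : Fin n) :
    ((i, j) ∉ Ω → x'.Y₄ i j = 0) ∧
      ((i, j) ∈ Ω → x'.S i j ≠ 0 → x'.Y₄ i j = -halfGrad (x'.S i j)) ∧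
      |μ⁻¹ * x'.Y₄ i j| ≤ ((2 / μ) ^ (1 / 3 : ℝ)) ^ 2 := by
  obtain ⟨a, ha⟩ : ∃ a, a = D i j - x'.L i j - μ⁻¹ * x.Y₄ i j := ⟨_, rfl⟩
  have hY : x'.Y₄ i j = μ * (x'.S i j - a) := by
    rw [h.Y₄_eq, ha]
    simp only [Matrix.add_apply, Matrix.smul_apply, Matrix.sub_apply, smul_eq_mul]
    field_simp
    ring
  have hμY : μ⁻¹ * x'.Y₄ i j = x'.S i j - a := by
    rw [hY, inv_mul_cancel_left₀ hμ.ne']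
  rw [hμY]
  by_cases hij : (i, j) ∈ Ω
  · have hS : x'.S i j = halfThreshold (2 / μ) a := by
      rw [h.S_eq, Matrix.add_apply, proj_apply_mem _ hij,
        proj_apply_notMem _ (Set.notMem_compl_iff.2 hij), ha]
      simp [halfThresholdMat]
    obtain ⟨h1, h2⟩ := halfThreshold_spec (γ := 2 / μ) (by positivity) a
    rw [← hS] at h1 h2
    refine ⟨fun h => absurd hij h, fun _ h0 => ?_, by rwa [abs_sub_comm] at h2⟩
    rw [hY, ← neg_sub, h1 h0]
    field_simp
  · have hS : x'.S i j = a := by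
      rw [h.S_eq, Matrix.add_apply, proj_apply_notMem _ hij, proj_apply_mem _ hij, ha]
      simp
    rw [hY, hS, sub_self, mul_zero, abs_zero]
    exact ⟨fun _ => rfl, fun h => absurd h hij, by positivity⟩

/-! ### Sequences of real numbers -/

/-- Monotonicity bounds `μ k ^ (-1/3)` by the given ratio, and `(μ k)⁻¹` is its cube, eventually
smaller. -/
lemma summable_inv_of_summable_ratio {μ : ℕ → ℝ} (hpos : ∀ k, 0 < μ k) (hmono : Monotone μ)
    (hsum : Summable fun k => μ (k + 1) / μ k ^ (4 / 3 : ℝ)) : Summable fun k => (μ k)⁻¹ := by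
  have hle : ∀ k, μ k ^ (-(1 / 3) : ℝ) ≤ μ (k + 1) / μ k ^ (4 / 3 : ℝ) := by
    intro k
    have h1 : μ k ^ (-(1 / 3) : ℝ) = μ k / μ k ^ (4 / 3 : ℝ) := by
      rw [eq_div_iff (Real.rpow_pos_of_pos (hpos k) _).ne', ← Real.rpow_add (hpos k)]
      norm_num
    rw [h1]
    have h2 := Real.rpow_pos_of_pos (hpos k) (4 / 3)
    exact div_le_div_of_nonneg_right (hmono k.le_succ) h2.le
  have hs : Summable fun k => μ k ^ (-(1 / 3) : ℝ) :=
    Summable.of_nonneg_of_le (fun k => (Real.rpow_pos_of_pos (hpos k) _).le) hle hsum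
  refine Summable.of_norm_bounded_eventually_nat hs ?_
  filter_upwards [hs.tendsto_atTop_zero.eventually (gt_mem_nhds one_pos)] with k hk
  have h0 := Real.rpow_pos_of_pos (hpos k) (-(1 / 3))
  have h3 : (μ k)⁻¹ = (μ k ^ (-(1 / 3) : ℝ)) ^ 3 := by
    rw [← Real.rpow_natCast, ← Real.rpow_mul (hpos k).le, ← Real.rpow_neg_one]
    norm_num
  rw [Real.norm_of_nonneg (inv_nonneg.2 (hpos k).le), h3]
  exact pow_le_of_le_one h0.le hk.le (by norm_num)

/-- A discrete Grönwall inequality. -/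
lemma exists_bound_of_le_add_mul {a c : ℕ → ℝ} (ha : ∀ k, 0 ≤ a k) (hc : ∀ k, 0 ≤ c k)
    (hsum : Summable c) (h : ∀ k, a (k + 1) ≤ a k + c k * (1 + a k)) : ∃ B, ∀ k, a k ≤ B := by
  have key : ∀ k, 1 + a k ≤ (1 + a 0) * Real.exp (∑ i ∈ Finset.range k, c i) := by
    intro k
    induction k with
    | zero => simp
    | succ k ih =>
      rw [Finset.sum_range_succ, Real.exp_add, ← mul_assoc]
      calc 1 + a (k + 1) ≤ (1 + a k) * (c k + 1) := by linarith [h k]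
        _ ≤ _ := mul_le_mul ih (Real.add_one_le_exp _) (by linarith [hc k])
            (mul_nonneg (by linarith [ha 0]) (Real.exp_pos _).le)
  refine ⟨(1 + a 0) * Real.exp (∑' i, c i), fun k => ?_⟩
  have h1 : Real.exp (∑ i ∈ Finset.range k, c i) ≤ Real.exp (∑' i, c i) :=
    Real.exp_le_exp.2 (hsum.sum_le_tsum _ fun i _ => hc i)
  have h2 := mul_le_mul_of_nonneg_left h1 (by linarith [ha 0] : 0 ≤ 1 + a 0)
  linarith [key k]

/-! ### Convergence of matrix sequences from entrywise estimates -/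

lemma tendsto_matrix_iff {m n : ℕ} {ι : Type*} {l : Filter ι}
    {A : ι → Matrix (Fin m) (Fin n) ℝ} {B : Matrix (Fin m) (Fin n) ℝ} :
    Tendsto A l (𝓝 B) ↔ ∀ i j, Tendsto (fun k => A k i j) l (𝓝 (B i j)) := by
  refine tendsto_pi_nhds.trans (forall_congr' fun i => ?_)
  exact tendsto_pi_nhds

/-- The index shift reflects that the initial state is arbitrary: residual estimates hold only for
states produced by a step. -/
lemma exists_tendsto_of_summable {m n : ℕ} {A : ℕ → Matrix (Fin m) (Fin n) ℝ} {c : ℕ → ℝ}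
    (hc : Summable c) (h : ∀ k i j, |A (k + 2) i j - A (k + 1) i j| ≤ c k) :
    ∃ B, Tendsto A atTop (𝓝 B) := by
  have key : ∀ i j, ∃ b, Tendsto (fun k => A (k + 1) i j) atTop (𝓝 b) := by
    intro i j
    refine cauchySeq_tendsto_of_complete (cauchySeq_of_dist_le_of_summable c (fun k => ?_) hc)
    rw [dist_comm, Real.dist_eq]
    exact h k i j
  choose b hb using key
  refine ⟨of b, tendsto_matrix_iff.2 fun i j => ?_⟩
  exact (tendsto_add_atTop_iff_nat (f := fun k => A k i j) 1).1 (hb i j)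

lemma tendsto_zero_of_entry_le {m n : ℕ} {A : ℕ → Matrix (Fin m) (Fin n) ℝ} {c : ℕ → ℝ}
    (hc : Tendsto c atTop (𝓝 0)) (h : ∀ k i j, |A (k + 1) i j| ≤ c k) :
    Tendsto A atTop (𝓝 0) := by
  refine tendsto_matrix_iff.2 fun i j => ?_
  refine (tendsto_add_atTop_iff_nat (f := fun k => A k i j) 1).1 ?_
  exact squeeze_zero_norm (fun k => h k i j) hc

/-! ### Convergence of the iterates -/

variable {m n d : ℕ} {Ω : Set (Fin m × Fin n)} {D : Matrix (Fin m) (Fin n) ℝ} {lam : ℝ}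
  {μ : ℕ → ℝ} {x : ℕ → State m n d}

section Estimates

open scoped Matrix.Norms.L2Operator

lemma exists_multipliersLE (hlam : 0 < lam) (hμpos : ∀ k, 0 < μ k)
    (hx : ∀ k, ADMMStep Ω D lam (μ k) (x k) (x (k + 1)))
    (hY₃ : ∃ C : ℝ, ∀ k, frobNorm (x k).Y₃ ≤ C) : ∃ C, 0 ≤ C ∧ ∀ k, (x k).MultipliersLE C := by
  obtain ⟨C, hC⟩ := hY₃
  obtain ⟨K, hK⟩ := @exists_opNorm_le_mul m n
  have h3 : ∀ k, ‖(x k).Y₃‖ ≤ K * C := fun k =>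
    hK _ _ fun i j => (abs_apply_le_frobNorm _ i j).trans (hC k)
  refine ⟨max (lam / 2) (max (max ‖(x 0).Y₁‖ ‖(x 0).Y₂‖) (K * C)),
    le_max_of_le_left (by positivity), fun k => ⟨?_, ?_, ?_⟩⟩
  · cases k with
    | zero => simp
    | succ k => exact le_max_of_le_left ((hx k).opNorm_Y₁_le hlam (hμpos k))
  · cases k with
    | zero => simp
    | succ k => exact le_max_of_le_left ((hx k).opNorm_Y₂_le hlam (hμpos k))
  · exact le_max_of_le_right (le_max_of_le_right (h3 k))

lemma exists_summable_entry_bounds (hlam : 0 < lam) (hμpos : ∀ k, 0 < μ k) (hμmono : Monotone μ)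
    (hμsum : Summable fun k => (μ k)⁻¹)
    (hx : ∀ k, ADMMStep Ω D lam (μ k) (x k) (x (k + 1)))
    (hY₃ : ∃ C : ℝ, ∀ k, frobNorm (x k).Y₃ ≤ C) :
    ∃ c : ℕ → ℝ, Summable c ∧
      (∀ k i j, |(x (k + 2)).U i j - (x (k + 1)).U i j| ≤ c k) ∧
      (∀ k i j, |(x (k + 2)).V i j - (x (k + 1)).V i j| ≤ c k) ∧
      (∀ k i j, |((x (k + 1)).Uhat - (x (k + 1)).U) i j| ≤ c k) ∧
      (∀ k i j, |((x (k + 1)).Vhat - (x (k + 1)).V) i j| ≤ c k) ∧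
      (∀ k i j, |((x (k + 1)).U * (x (k + 1)).Vᵀ - (x (k + 1)).L) i j| ≤ c k) := by
  obtain ⟨C, hC0, hC⟩ := exists_multipliersLE hlam hμpos hx hY₃
  have hμi : ∀ k, 0 < (μ k)⁻¹ := fun k => inv_pos.2 (hμpos k)
  have hVstep : ∀ k, ‖(x (k + 2)).V - (x (k + 1)).V‖ ≤
      6 * C * (μ k)⁻¹ * (1 + ‖(x (k + 1)).V‖) := fun k =>
    (hx k).opNorm_sub_V_le (hx (k + 1)) (hμpos k) (hμmono k.le_succ) (hC k) (hC (k + 1))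
  obtain ⟨B, hB⟩ := exists_bound_of_le_add_mul (a := fun k => ‖(x (k + 1)).V‖)
    (c := fun k => 6 * C * (μ k)⁻¹) (fun k => norm_nonneg _)
    (fun k => mul_nonneg (by positivity) (hμi k).le) (hμsum.mul_left _) fun k => by
      have h1 := norm_sub_norm_le (x (k + 2)).V (x (k + 1)).V
      linarith [hVstep k]
  have hB0 : 0 ≤ B := (norm_nonneg _).trans (hB 0)
  have hle : ∀ k, 6 * C * (μ k)⁻¹ ≤ 6 * C * (1 + B) * (μ k)⁻¹ := fun k => by
    have : 0 ≤ 6 * C * (μ k)⁻¹ * B := mul_nonneg (mul_nonneg (by positivity) (hμi k).le) hB0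
    linarith
  have hle' : ∀ k, 2 * C * (μ k)⁻¹ ≤ 6 * C * (1 + B) * (μ k)⁻¹ := fun k => by
    have : 0 ≤ C * (μ k)⁻¹ := mul_nonneg hC0 (hμi k).le
    linarith [hle k]
  refine ⟨fun k => 6 * C * (1 + B) * (μ k)⁻¹, hμsum.mul_left _, ?_, ?_, ?_, ?_, ?_⟩
  · intro k i j
    exact (abs_apply_le_opNorm ((x (k + 2)).U - (x (k + 1)).U) i j).trans
      (((hx k).opNorm_sub_U_le (hx (k + 1)) (hμpos k) (hμmono k.le_succ) (hC k)
        (hC (k + 1))).trans (hle k))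
  · intro k i j
    refine (abs_apply_le_opNorm ((x (k + 2)).V - (x (k + 1)).V) i j).trans ((hVstep k).trans ?_)
    have : 6 * C * (μ k)⁻¹ * ‖(x (k + 1)).V‖ ≤ 6 * C * (μ k)⁻¹ * B :=
      mul_le_mul_of_nonneg_left (hB k) (mul_nonneg (by positivity) (hμi k).le)
    linarith
  · intro k i j
    exact (abs_apply_le_opNorm _ i j).trans
      ((opNorm_residual_le (hμpos k) (hx k).Y₁_eq (hC k).1 (hC (k + 1)).1).trans (hle' k))
  · intro k i j
    exact (abs_apply_le_opNorm _ i j).trans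
      ((opNorm_residual_le (hμpos k) (hx k).Y₂_eq (hC k).2.1 (hC (k + 1)).2.1).trans (hle' k))
  · intro k i j
    exact (abs_apply_le_opNorm _ i j).trans
      ((opNorm_residual_le (hμpos k) (hx k).Y₃_eq (hC k).2.2 (hC (k + 1)).2.2).trans (hle' k))

lemma ADMMStep.abs_Y₁_apply_le {x x' : State m n d} {μ : ℝ} (h : ADMMStep Ω D lam μ x x')
    (hlam : 0 < lam) (hμ : 0 < μ) (i : Fin m) (j : Fin d) : |x'.Y₁ i j| ≤ lam / 2 :=
  (abs_apply_le_opNorm _ i j).trans (h.opNorm_Y₁_le hlam hμ)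

lemma ADMMStep.abs_Y₂_apply_le {x x' : State m n d} {μ : ℝ} (h : ADMMStep Ω D lam μ x x')
    (hlam : 0 < lam) (hμ : 0 < μ) (i : Fin n) (j : Fin d) : |x'.Y₂ i j| ≤ lam / 2 :=
  (abs_apply_le_opNorm _ i j).trans (h.opNorm_Y₂_le hlam hμ)

lemma mem_convexSubdiff_of_isSVT {p q : ℕ} {U Uhat Y Y' : Matrix (Fin p) (Fin q) ℝ} {μ : ℝ}
    (hlam : 0 < lam) (hμ : 0 < μ) (hsvt : IsSVT (lam / (2 * μ)) (U - μ⁻¹ • Y) Uhat)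
    (hY : Y' = Y + μ • (Uhat - U)) : (-(2 / lam)) • Y' ∈ convexSubdiff nuclearNorm Uhat := by
  obtain ⟨G, h1, h2, h3⟩ := exists_dual_of_isSVT hlam hμ hsvt hY
  have h4 : (-(2 / lam)) • Y' = G := by
    rw [h3, smul_neg, neg_smul, neg_neg, smul_smul]
    rw [show 2 / lam * (lam / 2) = 1 by field_simp, one_smul]
  rw [h4]
  exact mem_convexSubdiff_nuclearNorm h1 h2

end Estimates

lemma tendsto_feasibility_residual (hμpos : ∀ k, 0 < μ k) (hμmono : Monotone μ)
    (hμ : Tendsto (fun k => (μ k)⁻¹) atTop (𝓝 0))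
    (hx : ∀ k, ADMMStep Ω D lam (μ k) (x k) (x (k + 1))) :
    Tendsto (fun k => (x k).L + (x k).S - D) atTop (𝓝 0) := by
  have hc : Tendsto (fun k => ((2 / μ k) ^ (1 / 3 : ℝ)) ^ 2) atTop (𝓝 0) := by
    have h1 : Tendsto (fun k => 2 * (μ k)⁻¹) atTop (𝓝 0) := by simpa using hμ.const_mul 2
    have h2 := (h1.rpow_const (p := 1 / 3) (Or.inr (by norm_num))).pow 2
    rw [Real.zero_rpow (by norm_num), zero_pow (by norm_num)] at h2
    simpa only [div_eq_mul_inv] using h2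
  rw [← tendsto_add_atTop_iff_nat 1]
  refine tendsto_zero_of_entry_le (c := fun k => ((2 / μ (k + 1)) ^ (1 / 3 : ℝ)) ^ 2 +
    ((2 / μ k) ^ (1 / 3 : ℝ)) ^ 2) ?_ fun k i j => ?_
  · simpa using ((tendsto_add_atTop_iff_nat 1).2 hc).add hc
  have h1 := ((hx (k + 1)).Y₄_apply (hμpos _) i j).2.2
  have h2 := ((hx k).Y₄_apply (hμpos _) i j).2.2
  have h3 : |(μ (k + 1))⁻¹ * (x (k + 1)).Y₄ i j| ≤ |(μ k)⁻¹ * (x (k + 1)).Y₄ i j| := by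
    rw [abs_mul, abs_mul, abs_of_pos (inv_pos.2 (hμpos _)), abs_of_pos (inv_pos.2 (hμpos _))]
    exact mul_le_mul_of_nonneg_right (inv_anti₀ (hμpos k) (hμmono k.le_succ)) (abs_nonneg _)
  -- The feasibility residual is a difference of two scaled `Y₄`, each of which tends to 0 although
  -- `Y₄` itself may be unbounded.
  have h4 : ((x (k + 2)).L + (x (k + 2)).S - D) i j =
      (μ (k + 1))⁻¹ * (x (k + 2)).Y₄ i j - (μ (k + 1))⁻¹ * (x (k + 1)).Y₄ i j := by
    rw [(hx (k + 1)).Y₄_eq]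
    simp only [Matrix.add_apply, Matrix.smul_apply, Matrix.sub_apply, smul_eq_mul]
    have := (hμpos (k + 1)).ne'
    field_simp
    ring
  rw [show k + 1 + 1 = k + 2 from rfl, h4]
  exact (abs_sub _ _).trans (add_le_add h1 (h3.trans h2))

lemma exists_tendsto_iterates (hlam : 0 < lam) (hμpos : ∀ k, 0 < μ k) (hμmono : Monotone μ)
    (hμsum : Summable fun k => μ (k + 1) / μ k ^ (4 / 3 : ℝ))
    (hx : ∀ k, ADMMStep Ω D lam (μ k) (x k) (x (k + 1)))
    (hY₃ : ∃ C : ℝ, ∀ k, frobNorm (x k).Y₃ ≤ C) :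
    ∃ (U : Matrix (Fin m) (Fin d) ℝ) (V : Matrix (Fin n) (Fin d) ℝ),
      Tendsto (fun k => (x k).U) atTop (𝓝 U) ∧ Tendsto (fun k => (x k).V) atTop (𝓝 V) ∧
      Tendsto (fun k => (x k).Uhat) atTop (𝓝 U) ∧ Tendsto (fun k => (x k).Vhat) atTop (𝓝 V) ∧
      Tendsto (fun k => (x k).L) atTop (𝓝 (U * Vᵀ)) ∧
      Tendsto (fun k => (x k).S) atTop (𝓝 (D - U * Vᵀ)) := by
  have hsum := summable_inv_of_summable_ratio hμpos hμmono hμsum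
  obtain ⟨c, hc, hcU, hcV, hcU', hcV', hcL⟩ :=
    exists_summable_entry_bounds hlam hμpos hμmono hsum hx hY₃
  have hc0 := hc.tendsto_atTop_zero
  obtain ⟨U, hU⟩ := exists_tendsto_of_summable (A := fun k => (x k).U) hc hcU
  obtain ⟨V, hV⟩ := exists_tendsto_of_summable (A := fun k => (x k).V) hc hcV
  have hUV : Tendsto (fun k => (x k).U * (x k).Vᵀ) atTop (𝓝 (U * Vᵀ)) := by
    refine tendsto_matrix_iff.2 fun i j => ?_
    simp only [mul_apply, transpose_apply]
    exact tendsto_finsetSum _ fun l _ =>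
      (tendsto_matrix_iff.1 hU i l).mul (tendsto_matrix_iff.1 hV j l)
  have hL : Tendsto (fun k => (x k).L) atTop (𝓝 (U * Vᵀ)) := by
    simpa using hUV.sub
      (tendsto_zero_of_entry_le (A := fun k => (x k).U * (x k).Vᵀ - (x k).L) hc0 hcL)
  refine ⟨U, V, hU, hV, ?_, ?_, hL, ?_⟩
  · simpa using hU.add (tendsto_zero_of_entry_le (A := fun k => (x k).Uhat - (x k).U) hc0 hcU')
  · simpa using hV.add (tendsto_zero_of_entry_le (A := fun k => (x k).Vhat - (x k).V) hc0 hcV')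
  · have h := (tendsto_feasibility_residual hμpos hμmono hsum.tendsto_atTop_zero hx).sub hL
    have h2 := h.add (tendsto_const_nhds (x := D))
    have e1 : (fun k => (x k).L + (x k).S - D - (x k).L + D) = fun k => (x k).S := by
      funext k
      abel
    have e2 : 0 - U * Vᵀ + D = D - U * Vᵀ := by abel
    rwa [e1, e2] at h2

/-! ### Limit points of the iterates -/

lemma halfGrad_eq (s : ℝ) : halfGrad s = s / |s| / (2 * √|s|) := by
  unfold halfGrad
  congr 1
  rcases lt_trichotomy s 0 with h | rfl | h
  · rw [Real.sign_of_neg h, abs_of_neg h, div_neg, div_self h.ne]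
  · simp
  · rw [Real.sign_of_pos h, abs_of_pos h, div_self h.ne']

lemma continuousAt_halfGrad {s : ℝ} (hs : s ≠ 0) : ContinuousAt halfGrad s := by
  rw [funext halfGrad_eq]
  have h1 : |s| ≠ 0 := abs_ne_zero.2 hs
  have h2 : 2 * √|s| ≠ 0 := mul_ne_zero two_ne_zero (Real.sqrt_ne_zero'.2 (abs_pos.2 hs))
  exact (continuousAt_id.div continuous_abs.continuousAt h1).div
    (by fun_prop) h2

lemma stationary_of_tendsto {p q : ℕ} {X Y : ℕ → Matrix (Fin p) (Fin q) ℝ}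
    {X' Y' : Matrix (Fin p) (Fin q) ℝ} (hlam : 0 < lam)
    (h : ∀ᶠ k in atTop, (-(2 / lam)) • Y k ∈ convexSubdiff nuclearNorm (X k))
    (hX : Tendsto X atTop (𝓝 X')) (hY : Tendsto Y atTop (𝓝 Y')) :
    ∃ G ∈ convexSubdiff nuclearNorm X', (lam / 2) • G + Y' = 0 := by
  refine ⟨(-(2 / lam)) • Y', mem_convexSubdiff_nuclearNorm_of_tendsto (hY.const_smul _) hX h, ?_⟩
  rw [smul_smul, show lam / 2 * -(2 / lam) = -1 by field_simp, neg_one_smul, neg_add_cancel]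

lemma eventually_of_succ {φ : ℕ → ℕ} (hφ : StrictMono φ) {P : ℕ → Prop} (h : ∀ k, P (k + 1)) :
    ∀ᶠ k in atTop, P (φ k) := by
  filter_upwards [eventually_ge_atTop 1] with k hk
  obtain ⟨l, hl⟩ := Nat.exists_eq_succ_of_ne_zero
    (Nat.one_le_iff_ne_zero.1 (hk.trans (hφ.id_le k)))
  rw [hl]
  exact h l

/-- `Y₄` enters only through its entrywise conditions, so the lemma serves both a constructed
multiplier and a limit of the iterates. -/
lemma isKKT_of_tendsto (hlam : 0 < lam) (hμpos : ∀ k, 0 < μ k)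
    (hx : ∀ k, ADMMStep Ω D lam (μ k) (x k) (x (k + 1))) {φ : ℕ → ℕ} (hφ : StrictMono φ)
    {U : Matrix (Fin m) (Fin d) ℝ} {V : Matrix (Fin n) (Fin d) ℝ}
    (hU : Tendsto (fun k => (x k).Uhat) atTop (𝓝 U))
    (hV : Tendsto (fun k => (x k).Vhat) atTop (𝓝 V))
    {Y₁ : Matrix (Fin m) (Fin d) ℝ} {Y₂ : Matrix (Fin n) (Fin d) ℝ}
    {Y₄ : Matrix (Fin m) (Fin n) ℝ}
    (hY₁ : Tendsto (fun k => (x (φ k)).Y₁) atTop (𝓝 Y₁))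
    (hY₂ : Tendsto (fun k => (x (φ k)).Y₂) atTop (𝓝 Y₂))
    (hoff : ∀ i j, (i, j) ∉ Ω → Y₄ i j = 0)
    (hon : ∀ i j, (i, j) ∈ Ω → (D - U * Vᵀ) i j ≠ 0 → Y₄ i j = -halfGrad ((D - U * Vᵀ) i j)) :
    IsKKT Ω D lam U V U V (U * Vᵀ) (D - U * Vᵀ) Y₁ Y₂ Y₄ where
  stat_Uhat := stationary_of_tendsto hlam
    (eventually_of_succ hφ (P := fun k => (-(2 / lam)) • (x k).Y₁ ∈
      convexSubdiff nuclearNorm (x k).Uhat) fun k =>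
        mem_convexSubdiff_of_isSVT hlam (hμpos k) (hx k).Uhat_svt (hx k).Y₁_eq)
    (hU.comp hφ.tendsto_atTop) hY₁
  stat_Vhat := stationary_of_tendsto hlam
    (eventually_of_succ hφ (P := fun k => (-(2 / lam)) • (x k).Y₂ ∈
      convexSubdiff nuclearNorm (x k).Vhat) fun k =>
        mem_convexSubdiff_of_isSVT hlam (hμpos k) (hx k).Vhat_svt (hx k).Y₂_eq)
    (hV.comp hφ.tendsto_atTop) hY₂
  stat_S := exists_limitingSubdiff_Phi_add_eq_zero hon
  off_support := by
    ext i j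
    by_cases hij : (i, j) ∈ Ω
    · exact proj_apply_notMem _ (Set.notMem_compl_iff.2 hij)
    · exact (proj_apply_mem _ hij).trans (hoff i j hij)
  feas_L := rfl
  feas_Uhat := rfl
  feas_Vhat := rfl
  feas_D := add_sub_cancel _ _

lemma Y₄_limit_apply (hμpos : ∀ k, 0 < μ k)
    (hx : ∀ k, ADMMStep Ω D lam (μ k) (x k) (x (k + 1))) {φ : ℕ → ℕ} (hφ : StrictMono φ)
    {S Y₄ : Matrix (Fin m) (Fin n) ℝ} (hS : Tendsto (fun k => (x k).S) atTop (𝓝 S))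
    (hY₄ : Tendsto (fun k => (x (φ k)).Y₄) atTop (𝓝 Y₄)) (i : Fin m) (j : Fin n) :
    ((i, j) ∉ Ω → Y₄ i j = 0) ∧ ((i, j) ∈ Ω → S i j ≠ 0 → Y₄ i j = -halfGrad (S i j)) := by
  have hY := tendsto_matrix_iff.1 hY₄ i j
  have hSij : Tendsto (fun k => (x (φ k)).S i j) atTop (𝓝 (S i j)) :=
    (tendsto_matrix_iff.1 hS i j).comp hφ.tendsto_atTop
  constructor
  · intro hij
    have h := eventually_of_succ hφ (P := fun k => (x k).Y₄ i j = 0) fun k =>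
      ((hx k).Y₄_apply (hμpos k) i j).1 hij
    exact tendsto_nhds_unique hY (tendsto_const_nhds.congr' (h.mono fun k hk => hk.symm))
  · intro hij hS0
    have h := eventually_of_succ hφ
      (P := fun k => (x k).S i j ≠ 0 → (x k).Y₄ i j = -halfGrad ((x k).S i j)) fun k =>
      ((hx k).Y₄_apply (hμpos k) i j).2.1 hij
    have hg := ((continuousAt_halfGrad hS0).tendsto.comp hSij).neg
    refine tendsto_nhds_unique hY (hg.congr' ?_)
    filter_upwards [h, hSij.eventually_ne hS0] with k hk hk0
    exact (hk hk0).symm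

/-! ### Compactness and extraction of subsequences -/

instance {p q : ℕ} : FirstCountableTopology (Matrix (Fin p) (Fin q) ℝ) :=
  inferInstanceAs (FirstCountableTopology (Fin p → Fin q → ℝ))

lemma isCompact_setOf_abs_apply_le (p q : ℕ) (c : ℝ) :
    IsCompact {A : Matrix (Fin p) (Fin q) ℝ | ∀ i j, |A i j| ≤ c} := by
  have h : IsCompact (Set.univ.pi fun _ : Fin p => Set.univ.pi fun _ : Fin q => Set.Icc (-c) c) :=
    isCompact_univ_pi fun _ => isCompact_univ_pi fun _ => isCompact_Icc
  have e : {A : Matrix (Fin p) (Fin q) ℝ | ∀ i j, |A i j| ≤ c} =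
      Set.univ.pi fun _ : Fin p => Set.univ.pi fun _ : Fin q => Set.Icc (-c) c := by
    ext A
    simp only [Set.mem_ofPred_eq, abs_le]
    exact ⟨fun h i _ j _ => h i j, fun h i j => h i trivial j trivial⟩
  rw [e]
  exact h

lemma exists_subseq_tendsto_Y (hlam : 0 < lam) (hμpos : ∀ k, 0 < μ k)
    (hx : ∀ k, ADMMStep Ω D lam (μ k) (x k) (x (k + 1))) :
    ∃ (Y₁ : Matrix (Fin m) (Fin d) ℝ) (Y₂ : Matrix (Fin n) (Fin d) ℝ) (φ : ℕ → ℕ),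
      StrictMono φ ∧ Tendsto (fun k => (x (φ k)).Y₁) atTop (𝓝 Y₁) ∧
      Tendsto (fun k => (x (φ k)).Y₂) atTop (𝓝 Y₂) := by
  obtain ⟨Y, -, φ, hφ, h⟩ := ((isCompact_setOf_abs_apply_le m d (lam / 2)).prod
    (isCompact_setOf_abs_apply_le n d (lam / 2))).tendsto_subseq
    (x := fun k => ((x (k + 1)).Y₁, (x (k + 1)).Y₂)) fun k =>
      ⟨(hx k).abs_Y₁_apply_le hlam (hμpos k), (hx k).abs_Y₂_apply_le hlam (hμpos k)⟩
  refine ⟨Y.1, Y.2, fun k => φ k + 1, hφ.add_const 1, ?_, ?_⟩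
  · exact (continuous_fst.tendsto Y).comp h
  · exact (continuous_snd.tendsto Y).comp h

end HalfRPCA

theorem theorem3 {m n d : ℕ} (Ω : Set (Fin m × Fin n)) (D : Matrix (Fin m) (Fin n) ℝ)
    (lam : ℝ) (hlam : 0 < lam)
    (μ : ℕ → ℝ) (hμpos : ∀ k, 0 < μ k) (hμmono : Monotone μ)
    (hμsum : Summable fun k => μ (k + 1) / μ k ^ (4 / 3 : ℝ))
    (x : ℕ → HalfRPCA.State m n d)
    (hx : ∀ k, HalfRPCA.ADMMStep Ω D lam (μ k) (x k) (x (k + 1)))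
    (hY₃ : ∃ C : ℝ, ∀ k, HalfRPCA.frobNorm (x k).Y₃ ≤ C) :
    (CauchySeq (fun k => ((x k).U, (x k).V)) ∧
      CauchySeq (fun k => ((x k).Uhat, (x k).Vhat)) ∧
      CauchySeq (fun k => (x k).L) ∧
      CauchySeq (fun k => (x k).S)) ∧
    (∀ (U : Matrix (Fin m) (Fin d) ℝ) (V : Matrix (Fin n) (Fin d) ℝ)
        (Uhat : Matrix (Fin m) (Fin d) ℝ) (Vhat : Matrix (Fin n) (Fin d) ℝ)
        (L S : Matrix (Fin m) (Fin n) ℝ),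
      MapClusterPt (U, V, Uhat, Vhat, L, S) atTop (fun k => (x k).primal) →
      (∃ (Y₁ : Matrix (Fin m) (Fin d) ℝ) (Y₂ : Matrix (Fin n) (Fin d) ℝ)
          (Y₄ : Matrix (Fin m) (Fin n) ℝ),
        MapClusterPt ((U, V, Uhat, Vhat, L, S), Y₁, Y₂) atTop
          (fun k => ((x k).primal, (x k).Y₁, (x k).Y₂)) ∧
        HalfRPCA.IsKKT Ω D lam U V Uhat Vhat L S Y₁ Y₂ Y₄) ∧
      (∀ (Y₁ : Matrix (Fin m) (Fin d) ℝ) (Y₂ : Matrix (Fin n) (Fin d) ℝ)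
          (Y₄ : Matrix (Fin m) (Fin n) ℝ),
        MapClusterPt ((U, V, Uhat, Vhat, L, S), Y₁, Y₂, Y₄) atTop
          (fun k => ((x k).primal, (x k).Y₁, (x k).Y₂, (x k).Y₄)) →
        HalfRPCA.IsKKT Ω D lam U V Uhat Vhat L S Y₁ Y₂ Y₄)) := by
  obtain ⟨U₀, V₀, hU, hV, hU', hV', hL, hS⟩ :=
    HalfRPCA.exists_tendsto_iterates hlam hμpos hμmono hμsum hx hY₃
  have hprimal : Tendsto (fun k => (x k).primal) atTop
      (𝓝 (U₀, V₀, U₀, V₀, U₀ * V₀ᵀ, D - U₀ * V₀ᵀ)) :=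
    hU.prodMk_nhds (hV.prodMk_nhds (hU'.prodMk_nhds (hV'.prodMk_nhds (hL.prodMk_nhds hS))))
  refine ⟨⟨(hU.prodMk_nhds hV).cauchySeq, (hU'.prodMk_nhds hV').cauchySeq, hL.cauchySeq,
    hS.cauchySeq⟩, ?_⟩
  intro U V Uhat Vhat L S hcl
  obtain ⟨ψ, hψ, hψlim⟩ := hcl.tendsto_subseq
  -- The whole primal sequence converges, so its only cluster point is the limit.
  have heq := tendsto_nhds_unique hψlim (hprimal.comp hψ.tendsto_atTop)
  simp only [Prod.mk.injEq] at heq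
  obtain ⟨rfl, rfl, rfl, rfl, rfl, rfl⟩ := heq
  constructor
  · obtain ⟨Y₁, Y₂, φ, hφ, hY₁, hY₂⟩ := HalfRPCA.exists_subseq_tendsto_Y hlam hμpos hx
    classical
    -- `Y₄` is prescribed by the stationarity condition at the limit, since the iterates `Y₄` need
    -- not have a cluster point.
    refine ⟨Y₁, Y₂, Matrix.of fun i j => if (i, j) ∈ Ω then
      -HalfRPCA.halfGrad ((D - Uhat * Vhatᵀ) i j) else 0, ?_, ?_⟩
    · refine MapClusterPt.of_comp hφ.tendsto_atTop (Tendsto.mapClusterPt ?_)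
      exact (hprimal.comp hφ.tendsto_atTop).prodMk_nhds (hY₁.prodMk_nhds hY₂)
    · refine HalfRPCA.isKKT_of_tendsto hlam hμpos hx hφ hU' hV' hY₁ hY₂ ?_ ?_
      · intro i j hij
        rw [Matrix.of_apply, if_neg hij]
      · intro i j hij _
        rw [Matrix.of_apply, if_pos hij]
  · intro Y₁ Y₂ Y₄ hY
    obtain ⟨φ, hφ, hlim⟩ := hY.tendsto_subseq
    have hY' := (continuous_snd.tendsto _).comp hlim
    have hY₁ := (continuous_fst.tendsto _).comp hY'
    have hY₂₄ := (continuous_snd.tendsto _).comp hY'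
    have hY₂ := (continuous_fst.tendsto _).comp hY₂₄
    have hY₄ := (continuous_snd.tendsto _).comp hY₂₄
    exact HalfRPCA.isKKT_of_tendsto hlam hμpos hx hφ hU' hV' hY₁ hY₂
      (fun i j => (HalfRPCA.Y₄_limit_apply hμpos hx hφ hS hY₄ i j).1)
      (fun i j => (HalfRPCA.Y₄_limit_apply hμpos hx hφ hS hY₄ i j).2)
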